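/- Let $N$ be a finite integer and let $n_1,\dots,n_N\ge 2$ be integers. For each $i$ let $F(n_i)$ be the free group on standard generators $g_{i,1},\dots,g_{i,n_i}$, let $H_i=\langle g_{i,1}\rangle\subset F(n_i)$, and put $G=F(n_1)\times\cdots\times F(n_N)$, $H=H_1\times\cdots\times H_N$ and $G_i=F(n_1)\times\cdots\times F(n_{i-1})\times H_i\times F(n_{i+1})\times\cdots\times F(n_N)$. Let $\mathcal M_0$ be a finite von Neumann algebra with a faithful normal tracial state $\tau_0$, and let $G$ act on $\mathcal M_0$ by $\tau_0$-preserving automorphisms. Let $\mathcal M=\mathcal M_0\rtimes G$ be the crossed product von Neumann algebra, generated by $\mathcal M_0$ and the canonical unitaries $\lambda(g)$, $g\in G$, implementing the action, with the faithful normal tracial state $\tau$ extending $\tau_0$ and satisfying $\tau(a\lambda(g))=0$ for $a\in\mathcal M_0$ and $g\neq 1$. For a subgroup $L\subset G$ let $\mathcal M_L\subset\mathcal M$ be the von Neumann subalgebra generated by $\mathcal M_0$ and $\{\lambda(g):g\in L\}$, and put $\mathcal A=\mathcal M_H$ and $\mathcal N_i=\mathcal M_{G_i}$. Let $\omega$ be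 a free ultrafilter on $\mathbb N$. Let $\mathcal M^\omega$ be the quotient of $\ell^\infty(\mathbb N,\mathcal M)$ by the ideal of the bounded sequences $(x_n)$ with $\lim_{n\to\omega}\tau(x_n^*x_n)=0$, with the trace $\tau_\omega((x_n)_n)=\lim_{n\to\omega}\tau(x_n)$ and $\|z\|_2=\tau_\omega(z^*z)^{1/2}$. The algebra $\mathcal M$ is embedded in $\mathcal M^\omega$ as constant sequences, and for a von Neumann subalgebra $\mathcal B\subset\mathcal M$, $\mathcal B^\omega\subset\mathcal M^\omega$ is the set of classes of bounded sequences in $\mathcal B$. Let $E_{\mathcal B}:\mathcal M\to\mathcal B$ and $E_{\mathcal B^\omega}:\mathcal M^\omega\to\mathcal B^\omega$ denote the trace-preserving conditional expectations. Suppose that $x\in\mathcal M^\omega$ commutes with every element of $\mathcal A$ and that $$E_{\mathcal N_1^\omega}(x)=\cdots=E_{\mathcal N_N^\omega}(x)=E_{\mathcal A^\omega}(x).$$ Then for every $y\in\mathcal M$ with $E_{\mathcal N_1}(y)=\cdots=E_{\mathcal N_N}(y)=E_{\mathcal A}(y)=0$, $$\|yx-xy\|_2^2\ \ge\ \|y(x-E_{\mathcal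 A^\omega}(x))\|_2^2+\|(x-E_{\mathcal A^\omega}(x))y\|_2^2 .$$ -/

import Mathlib

open Filter Topology ComplexConjugate
open scoped ENNReal ComplexOrder InnerProductSpace

universe u v

noncomputable section

/-! ## Finite von Neumann algebras given by a separating trace vector, and their ultrapowers -/

/-- The von Neumann algebra on `K` generated by a set `S` of bounded operators:
the double commutant of `S ∪ S*`. -/
def vnGenerated {K : Type u} [NormedAddCommGroup K] [InnerProductSpace ℂ K] [CompleteSpace K]
    (S : Set (K →L[ℂ] K)) : VonNeumannAlgebra K where
  toStarSubalgebra :=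
    StarSubalgebra.centralizer ℂ ((StarSubalgebra.centralizer ℂ S : StarSubalgebra ℂ (K →L[ℂ] K)) :
      Set (K →L[ℂ] K))
  centralizer_centralizer' := by
    change Set.centralizer (Set.centralizer (Set.centralizer _)) = Set.centralizer _
    rw [Set.centralizer_centralizer_centralizer]

theorem mem_vnGenerated_iff {K : Type u} [NormedAddCommGroup K] [InnerProductSpace ℂ K]
    [CompleteSpace K] {S : Set (K →L[ℂ] K)} {x : K →L[ℂ] K} :
    x ∈ vnGenerated S ↔ ∀ t : K →L[ℂ] K, (∀ s ∈ S, s * t = t * s ∧ star s * t = t * star s) →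
      t * x = x * t := by
  change x ∈ StarSubalgebra.centralizer ℂ _ ↔ _
  rw [StarSubalgebra.mem_centralizer_iff]
  constructor
  · intro h t ht
    exact (h t (StarSubalgebra.mem_centralizer_iff ℂ |>.2 ht)).1
  · intro h t ht
    refine ⟨h t (StarSubalgebra.mem_centralizer_iff ℂ |>.1 ht),
      h _ (StarSubalgebra.mem_centralizer_iff ℂ |>.1 (star_mem ht))⟩

/-- A von Neumann algebra acting on the Hilbert space `K` together with a faithful normal tracial
state, the state being the vector state `x ↦ ⟨vec, x vec⟩` of a unit vector. -/
structure TracialVN (K : Type u) [NormedAddCommGroup K] [InnerProductSpace ℂ K]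
    [CompleteSpace K] where
  /-- the von Neumann algebra -/
  alg : VonNeumannAlgebra K
  /-- the trace vector -/
  vec : K
  norm_vec : ‖vec‖ = 1
  separating : ∀ x ∈ alg, x vec = 0 → x = 0
  tracial : ∀ x ∈ alg, ∀ y ∈ alg, ⟪vec, (x * y) vec⟫_ℂ = ⟪vec, (y * x) vec⟫_ℂ

/-- The `2`-norm `‖x‖₂ = t(x* x)^{1/2}` attached to a trace `t`. -/
def norm2 {R : Type u} [Mul R] [Star R] (t : R → ℂ) (x : R) : ℝ :=
  Real.sqrt (t (star x * x)).re

open Classical in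
/-- The trace preserving conditional expectation `E_B(x)` of `x` onto the von Neumann subalgebra
`B`, with respect to the faithful normal trace `t`: the unique element `e` of `B` such that
`t(e b) = t(x b)` for all `b ∈ B` (it exists for every von Neumann subalgebra `B`; the value `0`
in the other case is never used for these). -/
def condExp {R : Type u} [Ring R] (t : R → ℂ) (B : Set R) (x : R) : R :=
  if h : ∃ e ∈ B, ∀ b ∈ B, t (e * b) = t (x * b) then h.choose else 0

namespace TracialVN

variable {K : Type u} [NormedAddCommGroup K] [InnerProductSpace ℂ K] [CompleteSpace K]
  (M : TracialVN K)

/-- The trace `τ` of `M`. -/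
def trace (x : ↥M.alg) : ℂ := ⟪M.vec, (x : K →L[ℂ] K) M.vec⟫_ℂ

theorem trace_mul_comm (x y : ↥M.alg) : M.trace (x * y) = M.trace (y * x) :=
  M.tracial x x.2 y y.2

theorem trace_sub (x y : ↥M.alg) : M.trace (x - y) = M.trace x - M.trace y := by
  simp [trace]

theorem trace_star_mul (x y : ↥M.alg) :
    M.trace (star x * y) = ⟪(x : K →L[ℂ] K) M.vec, (y : K →L[ℂ] K) M.vec⟫_ℂ := by
  change ⟪M.vec, (star (x : K →L[ℂ] K) * (y : K →L[ℂ] K)) M.vec⟫_ℂ = _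
  rw [mul_apply_eq_comp, ContinuousLinearMap.star_eq_adjoint,
    ContinuousLinearMap.adjoint_inner_right]

theorem trace_star_mul_self (x : ↥M.alg) :
    M.trace (star x * x) = ((‖(x : K →L[ℂ] K) M.vec‖ ^ 2 : ℝ) : ℂ) := by
  rw [trace_star_mul, inner_self_eq_norm_sq_to_K]
  norm_cast

theorem norm_star_vec (x : ↥M.alg) :
    ‖((star x : ↥M.alg) : K →L[ℂ] K) M.vec‖ = ‖(x : K →L[ℂ] K) M.vec‖ := by
  have h1 := M.trace_star_mul_self x
  have h2 := M.trace_star_mul_self (star x)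
  rw [star_star, trace_mul_comm, h1] at h2
  have h3 : ‖(x : K →L[ℂ] K) M.vec‖ ^ 2 = ‖((star x : ↥M.alg) : K →L[ℂ] K) M.vec‖ ^ 2 := by
    exact_mod_cast h2
  exact ((sq_eq_sq₀ (norm_nonneg _) (norm_nonneg _)).1 h3).symm

theorem norm_mul_vec_le (x y : ↥M.alg) :
    ‖((x * y : ↥M.alg) : K →L[ℂ] K) M.vec‖ ≤ ‖x‖ * ‖(y : K →L[ℂ] K) M.vec‖ :=
  (x : K →L[ℂ] K).le_opNorm _

theorem norm_mul_vec_le' (x y : ↥M.alg) :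
    ‖((x * y : ↥M.alg) : K →L[ℂ] K) M.vec‖ ≤ ‖y‖ * ‖(x : K →L[ℂ] K) M.vec‖ := by
  rw [← norm_star_vec, star_mul, ← M.norm_star_vec x]
  refine (M.norm_mul_vec_le _ _).trans_eq ?_
  congr 1
  exact norm_star (y : K →L[ℂ] K)

instance : NormOneClass ↥M.alg where
  norm_one := by
    have : Nontrivial K := ⟨M.vec, 0, fun h => by simpa [h] using M.norm_vec⟩
    exact norm_one (α := K →L[ℂ] K)

instance : NormedStarGroup ↥M.alg where
  norm_star_le x := (norm_star (x : K →L[ℂ] K)).le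

/-- `ℓ^∞(ℕ, M)`. -/
abbrev BddSeq : Type u := lp (fun _ : ℕ => ↥M.alg) ∞

variable (ω : Ultrafilter ℕ)

/-- The `0`-ideal of the trace `τ_ω`: bounded sequences with `lim_{n → ω} τ(x_n* x_n) = 0`. -/
def nullSet : Set M.BddSeq :=
  {x | Tendsto (fun n => M.trace (star (x n) * x n)) ω (𝓝 0)}

theorem mem_nullSet_iff (x : M.BddSeq) :
    x ∈ M.nullSet ω ↔ Tendsto (fun n => ‖(x n : K →L[ℂ] K) M.vec‖) ω (𝓝 0) := by
  simp only [nullSet, Set.mem_ofPred_eq, trace_star_mul_self]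
  constructor
  · intro h
    have h1 := (Complex.continuous_re.tendsto _).comp h
    have h2 := (Real.continuous_sqrt.tendsto _).comp h1
    simpa [Function.comp_def, ← Complex.ofReal_pow] using h2
  · intro h
    have h1 := (Complex.continuous_ofReal.tendsto _).comp (h.pow 2)
    simpa [Function.comp_def] using h1

/-- The null sequences form an ideal of `ℓ^∞(ℕ, M)`. -/
def nullIdeal : Ideal M.BddSeq where
  carrier := M.nullSet ω
  zero_mem' := by
    rw [mem_nullSet_iff]
    simp
  add_mem' := by
    intro a b ha hb
    rw [mem_nullSet_iff] at *
    have := ha.add hb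
    rw [add_zero] at this
    exact squeeze_zero (fun _ => norm_nonneg _)
      (fun n => norm_add_le ((a n : K →L[ℂ] K) M.vec) ((b n : K →L[ℂ] K) M.vec)) this
  smul_mem' := by
    intro c x hx
    rw [mem_nullSet_iff] at *
    have := hx.const_mul ‖c‖
    rw [mul_zero] at this
    refine squeeze_zero (fun _ => norm_nonneg _) (fun n => ?_) this
    exact (M.norm_mul_vec_le (c n) (x n)).trans
      (mul_le_mul_of_nonneg_right (lp.norm_apply_le_norm ENNReal.top_ne_zero c n) (norm_nonneg _))

theorem mem_nullIdeal_iff (x : M.BddSeq) :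
    x ∈ M.nullIdeal ω ↔ Tendsto (fun n => ‖(x n : K →L[ℂ] K) M.vec‖) ω (𝓝 0) :=
  M.mem_nullSet_iff ω x

instance nullIdeal_isTwoSided : (M.nullIdeal ω).IsTwoSided where
  mul_mem_of_left := by
    intro x c hx
    rw [mem_nullIdeal_iff] at *
    have := hx.const_mul ‖c‖
    rw [mul_zero] at this
    refine squeeze_zero (fun _ => norm_nonneg _) (fun n => ?_) this
    exact (M.norm_mul_vec_le' (x n) (c n)).trans
      (mul_le_mul_of_nonneg_right (lp.norm_apply_le_norm ENNReal.top_ne_zero c n) (norm_nonneg _))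

theorem star_mem_nullIdeal (x : M.BddSeq) (hx : x ∈ M.nullIdeal ω) : star x ∈ M.nullIdeal ω := by
  rw [mem_nullIdeal_iff] at *
  refine hx.congr fun n => ?_
  exact (M.norm_star_vec (x n)).symm

/-- The ultrapower `M^ω`, the quotient of `ℓ^∞(ℕ, M)` by the `0`-ideal of `τ_ω`. -/
abbrev Ultrapower : Type u := M.BddSeq ⧸ M.nullIdeal ω

/-- The class in `M^ω` of a bounded sequence in `M`. -/
abbrev ofSeq (x : M.BddSeq) : M.Ultrapower ω := Ideal.Quotient.mk (M.nullIdeal ω) x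

/-- The adjoint on `M^ω` is the class of the entrywise adjoint. -/
instance : Star (M.Ultrapower ω) where
  star := Quotient.map' star (by
    intro a b hab
    rw [Submodule.quotientRel_def] at hab ⊢
    rw [← star_sub]
    exact M.star_mem_nullIdeal ω _ hab)

theorem star_ofSeq (x : M.BddSeq) : star (M.ofSeq ω x) = M.ofSeq ω (star x) := rfl

theorem norm_trace_le (x : ↥M.alg) : ‖M.trace x‖ ≤ ‖(x : K →L[ℂ] K) M.vec‖ := by
  refine (norm_inner_le_norm _ _).trans_eq ?_
  rw [M.norm_vec, one_mul]

/-- Along an ultrafilter, the traces of a bounded sequence converge. -/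
theorem exists_tendsto_trace (x : M.BddSeq) :
    ∃ c, Tendsto (fun n => M.trace (x n)) ω (𝓝 c) := by
  have hb : ∀ n, M.trace (x n) ∈ Metric.closedBall (0 : ℂ) ‖x‖ := by
    intro n
    rw [mem_closedBall_zero_iff]
    refine (M.norm_trace_le _).trans ?_
    refine ((x n : K →L[ℂ] K).le_opNorm _).trans ?_
    rw [M.norm_vec, mul_one]
    exact lp.norm_apply_le_norm ENNReal.top_ne_zero x n
  obtain ⟨c, -, hc⟩ := (isCompact_closedBall (0 : ℂ) ‖x‖).ultrafilter_le_nhds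
    (ω.map fun n => M.trace (x n)) (by
      rw [le_principal_iff]
      exact Filter.mem_map.2 (Filter.univ_mem' hb))
  exact ⟨c, hc⟩

/-- The trace `τ_ω` of `M^ω`: `τ_ω((x_n)_n) = lim_{n → ω} τ(x_n)`. -/
def ultraTrace : M.Ultrapower ω → ℂ :=
  fun x => Quotient.liftOn' x (fun a => limUnder (ω : Filter ℕ) fun n => M.trace (a n)) (by
    intro a b hab
    rw [Submodule.quotientRel_def, mem_nullIdeal_iff] at hab
    obtain ⟨c, hc⟩ := M.exists_tendsto_trace ω a
    obtain ⟨d, hd⟩ := M.exists_tendsto_trace ω b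
    have h0 : Tendsto (fun n => M.trace (a n) - M.trace (b n)) ω (𝓝 0) := by
      refine squeeze_zero_norm (fun n => ?_) hab
      rw [← trace_sub]
      exact M.norm_trace_le _
    have h1 : c - d = 0 := tendsto_nhds_unique (hc.sub hd) h0
    change limUnder (ω : Filter ℕ) (fun n => M.trace (a n)) =
      limUnder (ω : Filter ℕ) fun n => M.trace (b n)
    rw [hc.limUnder_eq, hd.limUnder_eq, sub_eq_zero.1 h1])

theorem tendsto_ultraTrace (x : M.BddSeq) :
    Tendsto (fun n => M.trace (x n)) ω (𝓝 (M.ultraTrace ω (M.ofSeq ω x))) := by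
  obtain ⟨c, hc⟩ := M.exists_tendsto_trace ω x
  have : M.ultraTrace ω (M.ofSeq ω x) = c := hc.limUnder_eq
  rwa [this]

/-- The embedding of `M` in `M^ω` as constant sequences. -/
def const (y : ↥M.alg) : M.Ultrapower ω :=
  M.ofSeq ω ⟨fun _ => y, memℓp_infty ⟨‖y‖, by rintro _ ⟨_, rfl⟩; exact le_rfl⟩⟩

/-- For a subalgebra `B` of `M`, the subalgebra `B^ω` of `M^ω`: the classes of bounded
sequences with all entries in `B`. -/
def subUltrapower (B : Set ↥M.alg) : Set (M.Ultrapower ω) :=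
  {z | ∃ x : M.BddSeq, (∀ n, x n ∈ B) ∧ M.ofSeq ω x = z}

/-- The trace preserving conditional expectation `E_B(y)` of `y ∈ M` onto `B ⊆ M`. -/
def condE (B : Set ↥M.alg) (y : ↥M.alg) : ↥M.alg := condExp M.trace B y

/-- The trace preserving conditional expectation `E_{B^ω}(x)` of `x ∈ M^ω` onto `B^ω ⊆ M^ω`. -/
def ultraCondE (B : Set ↥M.alg) (x : M.Ultrapower ω) : M.Ultrapower ω :=
  condExp (M.ultraTrace ω) (M.subUltrapower ω B) x

/-- The norm `‖x‖₂ = τ_ω(x* x)^{1/2}` on `M^ω`. -/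
def ultraNorm2 (x : M.Ultrapower ω) : ℝ := norm2 (M.ultraTrace ω) x

end TracialVN

/-! ## The crossed product by a trace preserving action -/

/-- Faithful normal tracial states on a von Neumann algebra; normality is the preservation of
suprema of increasing nets. -/
structure IsFaithfulNormalTracialState {M₀ : Type u} [CStarAlgebra M₀] [PartialOrder M₀]
    (τ₀ : M₀ →ₚ[ℂ] ℂ) : Prop where
  map_one : τ₀ 1 = 1
  faithful : ∀ a, τ₀ (star a * a) = 0 → a = 0
  normal : ∀ (s : Set M₀) (a : M₀), s.Nonempty → DirectedOn (· ≤ ·) s → IsLUB s a →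
    IsLUB (τ₀ '' s) (τ₀ a)
  tracial : ∀ a b, τ₀ (a * b) = τ₀ (b * a)

section Operators

variable {H : Type u} [NormedAddCommGroup H] [InnerProductSpace ℂ H] {G : Type v}

theorem memlp_weighted (σ : G ≃ G) (T : G → H →L[ℂ] H) (C : ℝ) (hC : ∀ g, ‖T g‖ ≤ C)
    (ξ : lp (fun _ : G => H) 2) :
    Summable fun g => ‖T g (ξ (σ g))‖ ^ 2 := by
  have h2 : Summable fun g => ‖ξ g‖ ^ 2 := by
    have := (lp.memℓp ξ).summable (by norm_num)
    simpa using this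
  have h3 : Summable fun g => C ^ 2 * ‖ξ (σ g)‖ ^ 2 :=
    (σ.summable_iff.2 h2).mul_left _
  refine h3.of_nonneg_of_le (fun g => by positivity) fun g => ?_
  rw [← mul_pow]
  gcongr
  exact ((T g).le_opNorm _).trans (mul_le_mul_of_nonneg_right (hC g) (norm_nonneg _))

/-- The bounded operator `(V ξ)(g) = T_g (ξ (σ g))` on `ℓ²(G, H)`, for a permutation `σ` of `G`
and a uniformly bounded family `T` of operators on `H`. -/
def weightedOp (σ : G ≃ G) (T : G → H →L[ℂ] H) (C : ℝ) (hC : ∀ g, ‖T g‖ ≤ C) :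
    lp (fun _ : G => H) 2 →L[ℂ] lp (fun _ : G => H) 2 :=
  LinearMap.mkContinuous
    { toFun := fun ξ => ⟨fun g => T g (ξ (σ g)), memℓp_gen (by
        simpa using memlp_weighted σ T C hC ξ)⟩
      map_add' := fun ξ η => by
        ext g
        exact map_add (T g) _ _
      map_smul' := fun c ξ => by
        ext g
        exact map_smul (T g) c _ }
    |C| (by
      intro ξ
      have h2 : Summable fun g => ‖ξ g‖ ^ 2 := by
        have := (lp.memℓp ξ).summable (by norm_num)
        simpa using this
      have e : ∀ η : lp (fun _ : G => H) 2, ‖η‖ ^ 2 = ∑' g, ‖η g‖ ^ 2 := by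
        intro η
        have := lp.norm_rpow_eq_tsum (p := 2) (by norm_num) η
        simpa using this
      refine (sq_le_sq₀ (norm_nonneg _) (by positivity)).1 ?_
      rw [e, mul_pow, e, sq_abs, ← σ.tsum_eq (fun g => ‖ξ g‖ ^ 2), ← tsum_mul_left]
      refine Summable.tsum_le_tsum (fun g => ?_) (memlp_weighted σ T C hC ξ)
        ((σ.summable_iff.2 h2).mul_left _)
      rw [← mul_pow]
      change ‖T g (ξ (σ g))‖ ^ 2 ≤ _
      gcongr
      exact ((T g).le_opNorm _).trans (mul_le_mul_of_nonneg_right (hC g) (norm_nonneg _)))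

@[simp]
theorem weightedOp_apply (σ : G ≃ G) (T : G → H →L[ℂ] H) (C : ℝ) (hC : ∀ g, ‖T g‖ ≤ C)
    (ξ : lp (fun _ : G => H) 2) (g : G) : weightedOp σ T C hC ξ g = T g (ξ (σ g)) := rfl

end Operators

section GNS

variable {M₀ : Type u} [CStarAlgebra M₀] [PartialOrder M₀] [StarOrderedRing M₀] (τ₀ : M₀ →ₚ[ℂ] ℂ)

/-- The canonical map `M₀ → L²(M₀, τ₀)`. -/
def gnsVec (a : M₀) : τ₀.GNS := ((τ₀.toPreGNS a : τ₀.PreGNS) : τ₀.GNS)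

theorem inner_gnsVec (a b : M₀) : ⟪gnsVec τ₀ a, gnsVec τ₀ b⟫_ℂ = τ₀ (star a * b) := by
  rw [gnsVec, gnsVec, UniformSpace.Completion.inner_coe, PositiveLinearMap.preGNS_inner_def]
  simp

theorem gnsStarAlgHom_gnsVec (a b : M₀) : τ₀.gnsStarAlgHom a (gnsVec τ₀ b) = gnsVec τ₀ (a * b) := by
  rw [gnsVec, gnsVec, PositiveLinearMap.gnsStarAlgHom_apply]
  exact (PositiveLinearMap.gnsNonUnitalStarAlgHom_apply_coe τ₀).trans (by simp)

theorem gns_induction {p : τ₀.GNS → Prop} (hp : IsClosed {ξ | p ξ}) (h : ∀ a, p (gnsVec τ₀ a))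
    (ξ : τ₀.GNS) : p ξ :=
  UniformSpace.Completion.induction_on ξ hp fun a => h (τ₀.ofPreGNS a)

theorem norm_gnsVec_star (htr : ∀ a b, τ₀ (a * b) = τ₀ (b * a)) (a : M₀) :
    ‖gnsVec τ₀ (star a)‖ = ‖gnsVec τ₀ a‖ := by
  rw [@norm_eq_sqrt_re_inner ℂ, @norm_eq_sqrt_re_inner ℂ, inner_gnsVec, inner_gnsVec, star_star, htr]

/-- Right multiplication by `c` on `L²(M₀, τ₀)`. -/
def gnsRight (htr : ∀ a b, τ₀ (a * b) = τ₀ (b * a)) (c : M₀) : τ₀.GNS →L[ℂ] τ₀.GNS :=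
  (LinearMap.mkContinuous
    { toFun := fun b : τ₀.PreGNS => τ₀.toPreGNS (τ₀.ofPreGNS b * c)
      map_add' := fun a b => by simp [add_mul]
      map_smul' := fun r a => by simp } ‖c‖ (by
    intro b
    have h1 : ‖τ₀.toPreGNS (τ₀.ofPreGNS b * c)‖ = ‖gnsVec τ₀ (τ₀.ofPreGNS b * c)‖ :=
      (UniformSpace.Completion.norm_coe _).symm
    have h2 : ‖b‖ = ‖gnsVec τ₀ (τ₀.ofPreGNS b)‖ := (UniformSpace.Completion.norm_coe _).symm
    change ‖τ₀.toPreGNS (τ₀.ofPreGNS b * c)‖ ≤ _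
    rw [h1, h2, ← norm_gnsVec_star τ₀ htr, ← norm_gnsVec_star τ₀ htr (τ₀.ofPreGNS b), star_mul,
      ← gnsStarAlgHom_gnsVec, ← norm_star c]
    exact (ContinuousLinearMap.le_opNorm _ _).trans
      (mul_le_mul_of_nonneg_right (NonUnitalStarAlgHom.norm_apply_le τ₀.gnsStarAlgHom _)
        (norm_nonneg _)))).completion

theorem gnsRight_gnsVec (htr : ∀ a b, τ₀ (a * b) = τ₀ (b * a)) (c b : M₀) :
    gnsRight τ₀ htr c (gnsVec τ₀ b) = gnsVec τ₀ (b * c) := by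
  rw [gnsRight, gnsVec, ContinuousLinearMap.completion_apply_coe]
  rfl

/-- The unitary of `L²(M₀, τ₀)` extending a trace preserving automorphism. -/
def gnsAut (β : M₀ ≃⋆ₐ[ℂ] M₀) (hβ : ∀ a, τ₀ (β a) = τ₀ a) : τ₀.GNS →L[ℂ] τ₀.GNS :=
  (LinearMap.mkContinuous
    { toFun := fun b : τ₀.PreGNS => τ₀.toPreGNS (β (τ₀.ofPreGNS b))
      map_add' := fun a b => by simp
      map_smul' := fun r a => by simp } 1 (by
    intro b
    have h1 : ‖τ₀.toPreGNS (β (τ₀.ofPreGNS b))‖ = ‖b‖ := by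
      rw [PositiveLinearMap.preGNS_norm_def, PositiveLinearMap.preGNS_norm_def]
      simp only [PositiveLinearMap.ofPreGNS_toPreGNS]
      rw [← map_star, ← map_mul, hβ]
    rw [one_mul]
    exact h1.le)).completion

theorem gnsAut_gnsVec (β : M₀ ≃⋆ₐ[ℂ] M₀) (hβ : ∀ a, τ₀ (β a) = τ₀ a) (b : M₀) :
    gnsAut τ₀ β hβ (gnsVec τ₀ b) = gnsVec τ₀ (β b) := by
  rw [gnsAut, gnsVec, ContinuousLinearMap.completion_apply_coe]
  rfl

theorem gnsRight_comm (htr : ∀ a b, τ₀ (a * b) = τ₀ (b * a)) (c a : M₀) (ξ : τ₀.GNS) :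
    gnsRight τ₀ htr c (τ₀.gnsStarAlgHom a ξ) = τ₀.gnsStarAlgHom a (gnsRight τ₀ htr c ξ) := by
  induction ξ using gns_induction with
  | hp => exact isClosed_eq (by fun_prop) (by fun_prop)
  | h b => simp only [gnsRight_gnsVec, gnsStarAlgHom_gnsVec, mul_assoc]

theorem gnsAut_comm (β : M₀ ≃⋆ₐ[ℂ] M₀) (hβ : ∀ a, τ₀ (β a) = τ₀ a) (a : M₀) (ξ : τ₀.GNS) :
    gnsAut τ₀ β hβ (τ₀.gnsStarAlgHom a ξ) = τ₀.gnsStarAlgHom (β a) (gnsAut τ₀ β hβ ξ) := by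
  induction ξ using gns_induction with
  | hp => exact isClosed_eq (by fun_prop) (by fun_prop)
  | h b => simp only [gnsAut_gnsVec, gnsStarAlgHom_gnsVec, map_mul]

theorem inner_one_gnsAut_gnsRight (htr : ∀ a b, τ₀ (a * b) = τ₀ (b * a)) (β : M₀ ≃⋆ₐ[ℂ] M₀)
    (hβ : ∀ a, τ₀ (β a) = τ₀ a) (c : M₀) (ξ : τ₀.GNS) :
    ⟪gnsVec τ₀ 1, gnsAut τ₀ β hβ (gnsRight τ₀ htr c ξ)⟫_ℂ = ⟪gnsVec τ₀ (star c), ξ⟫_ℂ := by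
  induction ξ using gns_induction with
  | hp => exact isClosed_eq (by fun_prop) (by fun_prop)
  | h b =>
    rw [gnsRight_gnsVec, gnsAut_gnsVec, inner_gnsVec, inner_gnsVec, star_one, one_mul, hβ,
      star_star, htr]

theorem norm_gnsStarAlgHom_apply_le (a : M₀) (β : M₀ ≃⋆ₐ[ℂ] M₀) :
    ‖τ₀.gnsStarAlgHom (β a)‖ ≤ ‖a‖ :=
  (NonUnitalStarAlgHom.norm_apply_le τ₀.gnsStarAlgHom _).trans
    (NonUnitalStarAlgHom.norm_apply_le β a)

end GNS

theorem inner_eq_inner_of_norms {K : Type u} [NormedAddCommGroup K] [InnerProductSpace ℂ K]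
    {p q p' q' : K} (a1 : ‖p' + q'‖ = ‖p + q‖) (a2 : ‖p' - q'‖ = ‖p - q‖)
    (a3 : ‖p' + Complex.I • q'‖ = ‖p - Complex.I • q‖)
    (a4 : ‖p' - Complex.I • q'‖ = ‖p + Complex.I • q‖) : ⟪p, q⟫_ℂ = ⟪q', p'⟫_ℂ := by
  rw [← inner_conj_symm q' p', inner_eq_sum_norm_sq_div_four p q,
    inner_eq_sum_norm_sq_div_four p' q']
  simp only [RCLike.I_to_complex, Complex.coe_algebraMap] at *
  rw [a1, a2, a3, a4]
  have h4 : (starRingEnd ℂ) 4 = 4 := map_ofNat _ 4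
  simp [h4]
  ring

namespace CrossedProduct

variable {M₀ : Type u} [CStarAlgebra M₀] [PartialOrder M₀] [StarOrderedRing M₀] (τ₀ : M₀ →ₚ[ℂ] ℂ)
  {G : Type v} [Group G] (α : G →* (M₀ ≃⋆ₐ[ℂ] M₀))

/-- The Hilbert space `ℓ²(G, L²(M₀, τ₀))` on which the crossed product acts. -/
abbrev Space (_α : G →* (M₀ ≃⋆ₐ[ℂ] M₀)) : Type (max u v) := lp (fun _ : G => τ₀.GNS) 2

/-- The copy of `M₀` in the crossed product: `(π(a) ξ)(g) = α_{g⁻¹}(a) ξ(g)`. -/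
def incl (a : M₀) : Space τ₀ α →L[ℂ] Space τ₀ α :=
  weightedOp (Equiv.refl G) (fun g => τ₀.gnsStarAlgHom (α g⁻¹ a)) ‖a‖
    fun g => norm_gnsStarAlgHom_apply_le τ₀ a (α g⁻¹)

/-- The canonical unitaries of the crossed product: `(λ(s) ξ)(g) = ξ(s⁻¹ g)`. -/
def lam (s : G) : Space τ₀ α →L[ℂ] Space τ₀ α :=
  weightedOp (Equiv.mulLeft s⁻¹) (fun _ => 1) 1 fun _ => ContinuousLinearMap.norm_id_le

/-- For a subgroup `L` of `G`, the von Neumann algebra generated by `M₀` and `λ(L)`. -/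
def vn (L : Subgroup G) : VonNeumannAlgebra (Space τ₀ α) :=
  vnGenerated (Set.range (incl τ₀ α) ∪ lam τ₀ α '' L)

open Classical in
/-- The vector `δ_1 ⊗ 1`. -/
def vec : Space τ₀ α := lp.single 2 (1 : G) (gnsVec τ₀ 1)

@[simp]
theorem incl_apply (a : M₀) (ξ : Space τ₀ α) (g : G) :
    incl τ₀ α a ξ g = τ₀.gnsStarAlgHom (α g⁻¹ a) (ξ g) := rfl

@[simp]
theorem lam_apply (s : G) (ξ : Space τ₀ α) (g : G) : lam τ₀ α s ξ g = ξ (s⁻¹ * g) := rfl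

theorem star_incl (a : M₀) : star (incl τ₀ α a) = incl τ₀ α (star a) := by
  symm
  rw [ContinuousLinearMap.star_eq_adjoint, ContinuousLinearMap.eq_adjoint_iff]
  intro ξ η
  rw [lp.inner_eq_tsum, lp.inner_eq_tsum]
  congr 1
  ext g
  rw [incl_apply, incl_apply, map_star, map_star, ContinuousLinearMap.star_eq_adjoint,
    ContinuousLinearMap.adjoint_inner_left]

theorem star_lam (s : G) : star (lam τ₀ α s) = lam τ₀ α s⁻¹ := by
  symm
  rw [ContinuousLinearMap.star_eq_adjoint, ContinuousLinearMap.eq_adjoint_iff]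
  intro ξ η
  rw [lp.inner_eq_tsum, lp.inner_eq_tsum, ← (Equiv.mulLeft s⁻¹).tsum_eq]
  congr 1
  ext g
  simp

/-- Operators commuting with `π(M₀)` and `λ(G)` commute with the crossed product. -/
theorem comm_of_mem {x t : Space τ₀ α →L[ℂ] Space τ₀ α} (hx : x ∈ vn τ₀ α ⊤)
    (h1 : ∀ a, incl τ₀ α a * t = t * incl τ₀ α a) (h2 : ∀ s, lam τ₀ α s * t = t * lam τ₀ α s) :
    t * x = x * t := by
  refine mem_vnGenerated_iff.1 hx t ?_
  rintro _ (⟨a, rfl⟩ | ⟨s, -, rfl⟩)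
  · exact ⟨h1 a, by rw [star_incl, h1]⟩
  · exact ⟨h2 s, by rw [star_lam, h2]⟩

section

variable (hτ₀ : IsFaithfulNormalTracialState τ₀) (hα : ∀ g a, τ₀ (α g a) = τ₀ a)

/-- Right multiplication by `c ∈ M₀`. -/
def right (c : M₀) : Space τ₀ α →L[ℂ] Space τ₀ α :=
  weightedOp (Equiv.refl G) (fun _ => gnsRight τ₀ hτ₀.tracial c) _ fun _ => le_rfl

/-- Right multiplication by `λ(s)⁻¹`. -/
def rightLam (s : G) : Space τ₀ α →L[ℂ] Space τ₀ α :=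
  weightedOp (Equiv.mulRight s) (fun _ => gnsAut τ₀ (α s) (hα s)) _ fun _ => le_rfl

@[simp]
theorem right_apply (c : M₀) (ξ : Space τ₀ α) (g : G) :
    right τ₀ α hτ₀ c ξ g = gnsRight τ₀ hτ₀.tracial c (ξ g) := rfl

@[simp]
theorem rightLam_apply (s : G) (ξ : Space τ₀ α) (g : G) :
    rightLam τ₀ α hα s ξ g = gnsAut τ₀ (α s) (hα s) (ξ (g * s)) := rfl

theorem right_comm_of_mem {x : Space τ₀ α →L[ℂ] Space τ₀ α} (hx : x ∈ vn τ₀ α ⊤) (c : M₀) :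
    right τ₀ α hτ₀ c * x = x * right τ₀ α hτ₀ c := by
  refine comm_of_mem τ₀ α hx (fun a => ?_) fun s => ?_
  · ext ξ g
    simp only [mul_apply_eq_comp, incl_apply, right_apply, gnsRight_comm]
  · ext ξ g
    simp only [mul_apply_eq_comp, lam_apply, right_apply]

theorem rightLam_comm_of_mem {x : Space τ₀ α →L[ℂ] Space τ₀ α} (hx : x ∈ vn τ₀ α ⊤) (s : G) :
    rightLam τ₀ α hα s * x = x * rightLam τ₀ α hα s := by
  refine comm_of_mem τ₀ α hx (fun a => ?_) fun t => ?_
  · ext ξ g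
    simp only [mul_apply_eq_comp, incl_apply, rightLam_apply, gnsAut_comm]
    rw [← StarAlgEquiv.mul_apply, ← map_mul]
    simp
  · ext ξ g
    simp only [mul_apply_eq_comp, lam_apply, rightLam_apply, mul_assoc]

open Classical in
theorem single_eq (g : G) (b : M₀) :
    (lp.single 2 g (gnsVec τ₀ b) : Space τ₀ α) =
      rightLam τ₀ α hα g⁻¹ (right τ₀ α hτ₀ (α g b) (vec τ₀ α)) := by
  ext h
  rw [rightLam_apply, right_apply, vec]
  by_cases hg : h = g
  · subst hg
    rw [lp.single_apply_self, mul_inv_cancel, lp.single_apply_self, gnsRight_gnsVec, gnsAut_gnsVec,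
      one_mul, ← StarAlgEquiv.mul_apply, ← map_mul]
    simp
  · rw [lp.single_apply_ne _ _ _ hg, lp.single_apply_ne, map_zero, map_zero]
    rwa [Ne, mul_inv_eq_one]

open Classical in
theorem apply_single {x : Space τ₀ α →L[ℂ] Space τ₀ α} (hx : x ∈ vn τ₀ α ⊤) (g : G) (b : M₀) :
    x (lp.single 2 g (gnsVec τ₀ b) : Space τ₀ α) =
      rightLam τ₀ α hα g⁻¹ (right τ₀ α hτ₀ (α g b) (x (vec τ₀ α))) := by
  rw [single_eq τ₀ α hτ₀ hα]
  have h1 := DFunLike.congr_fun (rightLam_comm_of_mem τ₀ α hα hx g⁻¹)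
    (right τ₀ α hτ₀ (α g b) (vec τ₀ α))
  have h2 := DFunLike.congr_fun (right_comm_of_mem τ₀ α hτ₀ hx (α g b)) (vec τ₀ α)
  simp only [mul_apply_eq_comp] at h1 h2
  rw [← h1, ← h2]

end

theorem vec_separating (hτ₀ : IsFaithfulNormalTracialState τ₀)
    (hα : ∀ g a, τ₀ (α g a) = τ₀ a)
    (x : Space τ₀ α →L[ℂ] Space τ₀ α) (hx : x ∈ vn τ₀ α ⊤)
    (h : x (vec τ₀ α) = 0) : x = 0 := by
  classical
  have h1 : ∀ (g : G) (ξ : τ₀.GNS), x (lp.single 2 g ξ : Space τ₀ α) = 0 := by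
    intro g ξ
    induction ξ using gns_induction with
    | hp =>
      exact isClosed_eq (x.continuous.comp (lp.isometry_single g).continuous) continuous_const
    | h b => rw [apply_single τ₀ α hτ₀ hα hx, h, map_zero, map_zero]
  ext1 ξ
  have h2 := (lp.hasSum_single (by norm_num) ξ).map x x.continuous
  have h3 : (⇑x ∘ fun g => (lp.single 2 g (ξ g) : Space τ₀ α)) = fun _ => 0 := by
    ext1 g
    exact h1 g _
  rw [h3] at h2
  exact (h2.unique hasSum_zero).trans rfl

theorem norm_star_apply_le (hτ₀ : IsFaithfulNormalTracialState τ₀)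
    (hα : ∀ g a, τ₀ (α g a) = τ₀ a)
    (x : Space τ₀ α →L[ℂ] Space τ₀ α) (hx : x ∈ vn τ₀ α ⊤) (g : G) :
    ‖(star x) (vec τ₀ α) g⁻¹‖ ≤ ‖x (vec τ₀ α) g‖ := by
  classical
  have key : ∀ ξ : τ₀.GNS, ‖⟪(star x) (vec τ₀ α) g⁻¹, ξ⟫_ℂ‖ ≤ ‖x (vec τ₀ α) g‖ * ‖ξ‖ := by
    intro ξ
    induction ξ using gns_induction with
    | hp => exact isClosed_le (by fun_prop) (by fun_prop)
    | h b =>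
      rw [← lp.inner_single_right, ContinuousLinearMap.star_eq_adjoint,
        ContinuousLinearMap.adjoint_inner_left, apply_single τ₀ α hτ₀ hα hx]
      conv_lhs => rw [vec]
      rw [lp.inner_single_left, rightLam_apply, right_apply, inner_one_gnsAut_gnsRight]
      rw [inv_inv, one_mul]
      refine (norm_inner_le_norm _ _).trans_eq ?_
      rw [mul_comm, norm_gnsVec_star τ₀ hτ₀.tracial]
      congr 1
      rw [@norm_eq_sqrt_re_inner ℂ, @norm_eq_sqrt_re_inner ℂ, inner_gnsVec, inner_gnsVec,
        ← map_star, ← map_mul, hα]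
  have h := key ((star x) (vec τ₀ α) g⁻¹)
  rw [inner_self_eq_norm_sq_to_K] at h
  by_contra hlt
  push Not at hlt
  have h0 : 0 < ‖(star x) (vec τ₀ α) g⁻¹‖ := (norm_nonneg _).trans_lt hlt
  simp only [norm_pow, RCLike.norm_ofReal, abs_norm] at h
  nlinarith

theorem norm_star_vec_le (hτ₀ : IsFaithfulNormalTracialState τ₀)
    (hα : ∀ g a, τ₀ (α g a) = τ₀ a)
    (x : Space τ₀ α →L[ℂ] Space τ₀ α) (hx : x ∈ vn τ₀ α ⊤) :
    ‖(star x) (vec τ₀ α)‖ ≤ ‖x (vec τ₀ α)‖ := by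
  have e : ∀ η : Space τ₀ α, ‖η‖ ^ 2 = ∑' g, ‖η g‖ ^ 2 := by
    intro η
    have := lp.norm_rpow_eq_tsum (p := 2) (by norm_num) η
    simpa using this
  have s : ∀ η : Space τ₀ α, Summable fun g => ‖η g‖ ^ 2 := by
    intro η
    have := (lp.memℓp η).summable (by norm_num)
    simpa using this
  refine (sq_le_sq₀ (norm_nonneg _) (norm_nonneg _)).1 ?_
  rw [e, e, ← (Equiv.inv G).tsum_eq]
  refine Summable.tsum_le_tsum (fun g => ?_) ((Equiv.inv G).summable_iff.2 (s _)) (s _)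
  have := norm_star_apply_le τ₀ α hτ₀ hα x hx g
  simp only [Equiv.inv_apply]
  gcongr

theorem vec_tracial (hτ₀ : IsFaithfulNormalTracialState τ₀)
    (hα : ∀ g a, τ₀ (α g a) = τ₀ a)
    (x : Space τ₀ α →L[ℂ] Space τ₀ α) (hx : x ∈ vn τ₀ α ⊤)
    (y : Space τ₀ α →L[ℂ] Space τ₀ α) (hy : y ∈ vn τ₀ α ⊤) :
    ⟪vec τ₀ α, (x * y) (vec τ₀ α)⟫_ℂ = ⟪vec τ₀ α, (y * x) (vec τ₀ α)⟫_ℂ := by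
  have hn : ∀ z ∈ vn τ₀ α ⊤, ‖(star z) (vec τ₀ α)‖ = ‖z (vec τ₀ α)‖ := by
    intro z hz
    refine le_antisymm (norm_star_vec_le τ₀ α hτ₀ hα z hz) ?_
    have := norm_star_vec_le τ₀ α hτ₀ hα (star z) (star_mem hz)
    rwa [star_star] at this
  have hsm : ∀ z ∈ vn τ₀ α ⊤, Complex.I • z ∈ vn τ₀ α ⊤ := fun z hz =>
    (vn τ₀ α ⊤).toStarSubalgebra.smul_mem hz _
  have e1 : ⟪vec τ₀ α, (x * y) (vec τ₀ α)⟫_ℂ = ⟪(star x) (vec τ₀ α), y (vec τ₀ α)⟫_ℂ := by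
    rw [ContinuousLinearMap.star_eq_adjoint, ContinuousLinearMap.adjoint_inner_left,
      mul_apply_eq_comp]
  have e2 : ⟪vec τ₀ α, (y * x) (vec τ₀ α)⟫_ℂ = ⟪(star y) (vec τ₀ α), x (vec τ₀ α)⟫_ℂ := by
    rw [ContinuousLinearMap.star_eq_adjoint, ContinuousLinearMap.adjoint_inner_left,
      mul_apply_eq_comp]
  have hx' : star x ∈ vn τ₀ α ⊤ := star_mem hx
  have a1 := hn (star x + y) (add_mem hx' hy)
  have a2 := hn (star x - y) (sub_mem hx' hy)
  have a3 := hn (star x - Complex.I • y) (sub_mem hx' (hsm y hy))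
  have a4 := hn (star x + Complex.I • y) (add_mem hx' (hsm y hy))
  rw [e1, e2]
  simp only [star_add, star_sub, star_star, star_smul, add_apply, sub_apply,
    smul_apply, Complex.star_def, Complex.conj_I, neg_smul, sub_neg_eq_add,
    ← sub_eq_add_neg] at a1 a2 a3 a4
  exact inner_eq_inner_of_norms a1 a2 a3 a4

end CrossedProduct

/-- The crossed product `M₀ ⋊ G` of a finite von Neumann algebra by a trace preserving action, on
`ℓ²(G, L²(M₀, τ₀))`, with its trace `τ(x) = ⟨δ_1 ⊗ 1, x (δ_1 ⊗ 1)⟩`, that is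
`τ(∑ a_g λ(g)) = τ₀(a_1)`. -/
def crossedProduct {M₀ : Type u} [CStarAlgebra M₀] [PartialOrder M₀] [StarOrderedRing M₀]
    (τ₀ : M₀ →ₚ[ℂ] ℂ) (hτ₀ : IsFaithfulNormalTracialState τ₀)
    {G : Type v} [Group G] (α : G →* (M₀ ≃⋆ₐ[ℂ] M₀)) (hα : ∀ g a, τ₀ (α g a) = τ₀ a) :
    TracialVN (CrossedProduct.Space τ₀ α) where
  alg := CrossedProduct.vn τ₀ α ⊤
  vec := CrossedProduct.vec τ₀ α
  norm_vec := by
    classical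
    rw [CrossedProduct.vec, lp.norm_single (by norm_num), @norm_eq_sqrt_re_inner ℂ, inner_gnsVec]
    simp [hτ₀.map_one]
  separating := CrossedProduct.vec_separating τ₀ α hτ₀ hα
  tracial := CrossedProduct.vec_tracial τ₀ α hτ₀ hα

/-- For a subgroup `L` of `G`, the von Neumann subalgebra `M_L` of `M = M₀ ⋊ G` generated by `M₀`
and `λ(L)`. -/
def crossedSub {M₀ : Type u} [CStarAlgebra M₀] [PartialOrder M₀] [StarOrderedRing M₀]
    (τ₀ : M₀ →ₚ[ℂ] ℂ) (hτ₀ : IsFaithfulNormalTracialState τ₀)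
    {G : Type v} [Group G] (α : G →* (M₀ ≃⋆ₐ[ℂ] M₀)) (hα : ∀ g a, τ₀ (α g a) = τ₀ a)
    (L : Subgroup G) : Set ↥(crossedProduct τ₀ hτ₀ α hα).alg :=
  {x | (x : CrossedProduct.Space τ₀ α →L[ℂ] CrossedProduct.Space τ₀ α) ∈ CrossedProduct.vn τ₀ α L}

/-! ## Products of free groups -/

/-- `G = F(n_1) × ⋯ × F(n_N)`. -/
abbrev FreeProd {N : ℕ} (n : Fin N → ℕ) : Type := ∀ i, FreeGroup (Fin (n i))

/-- The subgroup of `F(n)` generated by the first standard generator. -/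
def firstSubgroup (n : ℕ) (hn : 2 ≤ n) : Subgroup (FreeGroup (Fin n)) :=
  Subgroup.zpowers (FreeGroup.of ⟨0, by omega⟩)

/-- `G_i = F(n_1) × ⋯ × H_i × ⋯ × F(n_N)`. -/
def subG {N : ℕ} (n : Fin N → ℕ) (hn : ∀ i, 2 ≤ n i) (i : Fin N) : Subgroup (FreeProd n) :=
  (firstSubgroup (n i) (hn i)).comap (Pi.evalMonoidHom (fun i => FreeGroup (Fin (n i))) i)

/-- `H = H_1 × ⋯ × H_N`. -/
def subH {N : ℕ} (n : Fin N → ℕ) (hn : ∀ i, 2 ≤ n i) : Subgroup (FreeProd n) :=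
  Subgroup.pi Set.univ fun i => firstSubgroup (n i) (hn i)

section FreeProd

variable {M₀ : Type u} [CStarAlgebra M₀] [PartialOrder M₀] [StarOrderedRing M₀]
  (τ₀ : M₀ →ₚ[ℂ] ℂ) (hτ₀ : IsFaithfulNormalTracialState τ₀) {N : ℕ} {n : Fin N → ℕ}
  (hn : ∀ i, 2 ≤ n i) (α : FreeProd n →* (M₀ ≃⋆ₐ[ℂ] M₀)) (hα : ∀ g a, τ₀ (α g a) = τ₀ a)

/-- `A = M_H`, inside `M = M₀ ⋊ (F(n_1) × ⋯ × F(n_N))`. -/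
def algA : Set ↥(crossedProduct τ₀ hτ₀ α hα).alg := crossedSub τ₀ hτ₀ α hα (subH n hn)

/-- `N_i = M_{G_i}`, inside `M = M₀ ⋊ (F(n_1) × ⋯ × F(n_N))`. -/
def algN (i : Fin N) : Set ↥(crossedProduct τ₀ hτ₀ α hα).alg :=
  crossedSub τ₀ hτ₀ α hα (subG n hn i)

end FreeProd

end

/-! Put `e = E_{A^ω}(x)` and `Z = x - e`. Then `yx - xy = (yZ - Zy) + (ye - ey)`, so the square of
its 2-norm is `‖yZ‖² + ‖Zy‖² + ‖ye - ey‖²` plus cross terms. The inequality follows once the inner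
products among `yZ`, `Zy`, `ye`, `ey`, other than that of `ye` with `ey`, are shown to vanish
(`norm_sq_add_norm_sq_le`).

The vanishing comes from disjoint supports in `ℓ²(G, L²(M₀))`, seen in one coordinate `i` with first
generator `c`. The expectation onto `M_L` restricts coordinates to `L`
(`hasExpectation_crossedSub`). Since `E_{N_i}(y) = 0`, `y` is a 2-norm limit of sums of `λ(k)a` with
`k ∉ G_i`. Since `E_{N_i^ω}(x) = e`, the vectors representing `Z` live asymptotically off `G_i`. As
`x` commutes with the powers of `c`, these vectors are asymptotically invariant under conjugation by
them; such a conjugation shifts the exponent of the leading power of `c` (`lead_conj`), so a set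
with bounded exponent has arbitrarily many disjoint conjugates of almost equal mass, and hence
negligible mass (`tendsto_norm_chi_of_isWandering`). Thus `Z` lives on elements whose `i`-th
coordinate begins and ends with long powers of `c`.

Left translation by `k ∉ G_i` replaces the long leading power by that of `k` (`lead_mul_mul`), so it
separates `yZ` from `Zy`; the cosets supporting `ye` and `ey` are avoided likewise
(`separates_longEnds`). `commutator_inequality` assembles this. -/

noncomputable section

/-! ### Existence and contractivity of trace preserving conditional expectations. -/

section CondExp

variable {K : Type u} [NormedAddCommGroup K] [InnerProductSpace ℂ K] [CompleteSpace K]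

theorem inner_star_apply (T : K →L[ℂ] K) (ξ η : K) : ⟪(star T) ξ, η⟫_ℂ = ⟪ξ, T η⟫_ℂ := by
  rw [ContinuousLinearMap.star_eq_adjoint, ContinuousLinearMap.adjoint_inner_left]

theorem inner_apply_star (T : K →L[ℂ] K) (ξ η : K) : ⟪ξ, (star T) η⟫_ℂ = ⟪T ξ, η⟫_ℂ := by
  rw [ContinuousLinearMap.star_eq_adjoint, ContinuousLinearMap.adjoint_inner_right]

/-- If `T` commutes with `b* b`, then `‖b T ξ‖ ≤ ‖T‖ ‖b ξ‖`. -/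
theorem norm_apply_comp_le_of_commute (b T : K →L[ℂ] K) (h : Commute (star b * b) T) (ξ : K) :
    ‖b (T ξ)‖ ≤ ‖T‖ * ‖b ξ‖ := by
  -- `b` may be replaced by `|b|`, which gives the same norms and, as a function of `b* b`, commutes
  -- with `T`.
  have hr : CFC.abs b * CFC.abs b = star b * b := CFC.abs_mul_abs b
  have hn : ∀ η, ‖b η‖ = ‖CFC.abs b η‖ := by
    intro η
    rw [@norm_eq_sqrt_re_inner ℂ, @norm_eq_sqrt_re_inner ℂ, ← inner_star_apply, ← inner_star_apply,
      (CFC.abs_nonneg b).isSelfAdjoint.star_eq, ← mul_apply_eq_comp, ← mul_apply_eq_comp, hr]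
  have hc : Commute (CFC.abs b) T := h.cfcₙ_nnreal _
  rw [hn, hn]
  have := DFunLike.congr_fun hc.eq ξ
  simp only [mul_apply_eq_comp] at this
  rw [this]
  exact T.le_opNorm _

namespace TracialVN

variable (M : TracialVN K) {N : VonNeumannAlgebra K} (hN : ∀ x ∈ N, x ∈ M.alg)
  {P : K →L[ℂ] K} (hPs : star P = P) (hPP : P * P = P) (hPN : ∀ b ∈ N, P * b = b * P)
  (hPv : P M.vec = M.vec) (hP : ∀ ξ, P ξ ∈ closure {η | ∃ b ∈ N, b M.vec = η})

theorem inner_vec_comm {x y : K →L[ℂ] K} (hx : x ∈ M.alg) (hy : y ∈ M.alg) :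
    ⟪(star x) M.vec, y M.vec⟫_ℂ = ⟪(star y) M.vec, x M.vec⟫_ℂ := by
  rw [inner_star_apply, inner_star_apply]
  exact M.tracial x hx y hy

include hN hPs hPN hPv hP in
/-- The compression of an element of the commutant of `N` has the same modular conjugation as
its approximants from `N`. -/
theorem norm_proj_star_sub_le {t : K →L[ℂ] K} (ht : t ∈ N.commutant) {c : K →L[ℂ] K} (hc : c ∈ N) :
    ‖P ((star t) M.vec) - (star c) M.vec‖ ≤ ‖P (t M.vec) - c M.vec‖ := by
  have hcomm : ∀ b ∈ N, b * t = t * b := fun b hb => VonNeumannAlgebra.mem_commutant_iff.1 ht b hb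
  have hPb : ∀ b ∈ N, P (b M.vec) = b M.vec := by
    intro b hb
    have := DFunLike.congr_fun (hPN b hb) M.vec
    simpa [hPv] using this
  have swap : ∀ η ξ, ⟪P η, ξ⟫_ℂ = ⟪η, P ξ⟫_ℂ := fun η ξ => by rw [← inner_star_apply, hPs]
  -- Pairing with `b vec` suffices: commutation (for `t`) and traciality (for `c`) both move the
  -- star onto `b`, and `b`, `b*` have equal 2-norms.
  have h1 : ∀ η ∈ closure {η | ∃ b ∈ N, b M.vec = η},
      ‖⟪P ((star t) M.vec) - (star c) M.vec, η⟫_ℂ‖ ≤ ‖P (t M.vec) - c M.vec‖ * ‖η‖ := by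
    intro η hη
    refine closure_minimal (t := {η | ‖⟪P ((star t) M.vec) - (star c) M.vec, η⟫_ℂ‖ ≤
      ‖P (t M.vec) - c M.vec‖ * ‖η‖}) ?_ (isClosed_le (by fun_prop) (by fun_prop)) hη
    rintro _ ⟨b, hb, rfl⟩
    have e1 : ⟪P ((star t) M.vec), b M.vec⟫_ℂ = ⟪(star b) M.vec, P (t M.vec)⟫_ℂ := by
      rw [swap, hPb b hb, ← swap, hPb _ (star_mem hb), inner_star_apply, inner_star_apply,
        ← mul_apply_eq_comp, ← mul_apply_eq_comp, hcomm b hb]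
    have e2 : ⟪(star c) M.vec, b M.vec⟫_ℂ = ⟪(star b) M.vec, c M.vec⟫_ℂ :=
      M.inner_vec_comm (hN c hc) (hN b hb)
    change ‖⟪P ((star t) M.vec) - (star c) M.vec, b M.vec⟫_ℂ‖ ≤ _
    rw [inner_sub_left, e1, e2, ← inner_sub_right, mul_comm]
    refine (norm_inner_le_norm _ _).trans_eq ?_
    congr 1
    exact M.norm_star_vec ⟨b, hN b hb⟩
  have h2 := h1 (P ((star t) M.vec) - (star c) M.vec) (by
    rw [← hPb _ (star_mem hc), ← map_sub]
    exact hP _)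
  rw [inner_self_eq_norm_sq_to_K] at h2
  simp only [norm_pow, RCLike.norm_ofReal, abs_norm] at h2
  by_contra hlt
  push Not at hlt
  nlinarith [norm_nonneg (P (t M.vec) - c M.vec)]

include hN hPs hPP hPN hPv hP in
/-- The compressions of `M` and of the commutant of `N` to the closure of `N vec` commute. -/
theorem commute_compression {x : K →L[ℂ] K} (hx : x ∈ M.alg) {t : K →L[ℂ] K}
    (ht : t ∈ N.commutant) : Commute (P * t * P) (P * x * P) := by
  have hcomm : ∀ b ∈ N, b * t = t * b := fun b hb => VonNeumannAlgebra.mem_commutant_iff.1 ht b hb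
  have hcomm' : ∀ b ∈ N, b * star t = star t * b := fun b hb =>
    VonNeumannAlgebra.mem_commutant_iff.1 (star_mem ht) b hb
  have hPb : ∀ b ∈ N, P (b M.vec) = b M.vec := by
    intro b hb
    have := DFunLike.congr_fun (hPN b hb) M.vec
    simpa [hPv] using this
  have swap : ∀ η ξ, ⟪P η, ξ⟫_ℂ = ⟪η, P ξ⟫_ℂ := fun η ξ => by rw [← inner_star_apply, hPs]
  have idem : ∀ ξ, P (P ξ) = P ξ := fun ξ => DFunLike.congr_fun hPP ξ
  set D := P * t * P * (P * x * P) - P * x * P * (P * t * P) with hD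
  -- Approximate `P t vec` by `c_k vec` with `c_k ∈ N`; then `c_k* vec` tends to `P t* vec`. With
  -- `c_k` in place of `t`, the two matrix coefficients are `τ(c_k b* x a)` and `τ(b* x a c_k)`.
  have key : ∀ b ∈ N, ∀ a ∈ N, ⟪b M.vec, D (a M.vec)⟫_ℂ = 0 := by
    intro b hb a ha
    obtain ⟨w, hw, hwt⟩ := mem_closure_iff_seq_limit.1 (hP (t M.vec))
    choose c hc hcw using hw
    have hcs : Tendsto (fun k => (star (c k)) M.vec) atTop (𝓝 (P ((star t) M.vec))) := by
      rw [tendsto_iff_norm_sub_tendsto_zero] at hwt ⊢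
      refine squeeze_zero (fun _ => norm_nonneg _) (fun k => ?_) hwt
      rw [norm_sub_rev, norm_sub_rev (w k), ← hcw k]
      exact M.norm_proj_star_sub_le hN hPs hPN hPv hP ht (hc k)
    have e1 : ⟪b M.vec, (P * t * P * (P * x * P)) (a M.vec)⟫_ℂ =
        ⟪P ((star t) M.vec), (star b * x * a) M.vec⟫_ℂ := by
      simp only [mul_apply_eq_comp]
      rw [idem, hPb a ha, ← swap, hPb b hb, ← inner_star_apply t, ← swap,
        ← mul_apply_eq_comp (star t) b, ← hcomm' b hb, mul_apply_eq_comp, ← mul_apply_eq_comp P b,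
        hPN b hb, mul_apply_eq_comp, inner_apply_star]
    have e2 : ⟪b M.vec, (P * x * P * (P * t * P)) (a M.vec)⟫_ℂ =
        ⟪b M.vec, (x * a) (P (t M.vec))⟫_ℂ := by
      simp only [mul_apply_eq_comp]
      rw [idem, hPb a ha, ← swap, hPb b hb, ← mul_apply_eq_comp t a, ← hcomm a ha,
        mul_apply_eq_comp, ← mul_apply_eq_comp P a, hPN a ha, mul_apply_eq_comp]
    have e3 : ∀ k, ⟪(star (c k)) M.vec, (star b * x * a) M.vec⟫_ℂ =
        ⟪b M.vec, (x * a) (c k M.vec)⟫_ℂ := by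
      intro k
      have hxa : star b * x * a ∈ M.alg :=
        mul_mem (mul_mem (star_mem (hN b hb)) hx) (hN a ha)
      rw [inner_star_apply, ← mul_apply_eq_comp, M.tracial _ (hN _ (hc k)) _ hxa]
      simp only [mul_apply_eq_comp]
      rw [inner_apply_star]
    have l1 : Tendsto (fun k => ⟪(star (c k)) M.vec, (star b * x * a) M.vec⟫_ℂ) atTop
        (𝓝 ⟪P ((star t) M.vec), (star b * x * a) M.vec⟫_ℂ) := hcs.inner tendsto_const_nhds
    have l2 : Tendsto (fun k => ⟪b M.vec, (x * a) (c k M.vec)⟫_ℂ) atTop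
        (𝓝 ⟪b M.vec, (x * a) (P (t M.vec))⟫_ℂ) := by
      refine tendsto_const_nhds.inner (((x * a).continuous.tendsto _).comp ?_)
      simpa only [hcw] using hwt
    simp only [e3] at l1
    rw [hD, sub_apply, inner_sub_right, e1, e2, tendsto_nhds_unique l1 l2, sub_self]
  have hDP : ∀ ξ, D ξ = P (D (P ξ)) := by
    intro ξ
    simp only [hD, sub_apply, mul_apply_eq_comp, map_sub, idem]
  have hD0 : D = 0 := by
    ext ξ
    refine ext_inner_left ℂ fun η => ?_
    rw [hDP, ← swap, zero_apply, inner_zero_right]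
    have s1 : ∀ b ∈ N, ⟪b M.vec, D (P ξ)⟫_ℂ = 0 := by
      intro b hb
      exact closure_minimal (t := {ζ | ⟪b M.vec, D ζ⟫_ℂ = 0})
        (by rintro _ ⟨a, ha, rfl⟩; exact key b hb a ha)
        (isClosed_eq (by fun_prop) (by fun_prop)) (hP ξ)
    exact closure_minimal (t := {ζ | ⟪ζ, D (P ξ)⟫_ℂ = 0})
        (by rintro _ ⟨b, hb, rfl⟩; exact s1 b hb)
        (isClosed_eq (by fun_prop) (by fun_prop)) (hP η)
  exact sub_eq_zero.1 hD0

include hN hPs hPP hPN hPv hP in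
/-- The trace preserving conditional expectation of a finite von Neumann algebra `M` onto a
von Neumann subalgebra `N` exists, is contractive and is implemented by the projection `P` onto
the closure of `N vec`. -/
theorem exists_expectation (hcyc : Dense {η | ∃ t ∈ N.commutant, t M.vec = η})
    {x : K →L[ℂ] K} (hx : x ∈ M.alg) :
    ∃ e ∈ N, ‖e‖ ≤ ‖x‖ ∧ e M.vec = P (x M.vec) := by
  have idem : ∀ ξ, P (P ξ) = P ξ := fun ξ => DFunLike.congr_fun hPP ξ
  have hP1 : ‖P‖ ≤ 1 := by
    refine IsStarProjection.norm_le P ⟨hPP, hPs⟩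
  set T := P * x * P with hT
  have hTx : ‖T‖ ≤ ‖x‖ := by
    calc ‖T‖ ≤ ‖P‖ * ‖x‖ * ‖P‖ := (norm_mul_le _ _).trans (by gcongr; exact norm_mul_le _ _)
      _ ≤ 1 * ‖x‖ * 1 := by gcongr
      _ = ‖x‖ := by ring
  have hTv : T M.vec = P (x M.vec) := by simp [hT, hPv]
  -- The expectation is defined on the dense subspace `N' vec` by `t vec ↦ t P x vec`. It is bounded
  -- because `P x P` commutes with `P t* t P`, and its extension commutes with `N'`, hence lies in
  -- `N'' = N`.
  let f : N.commutant.toStarSubalgebra →ₗ[ℂ] K :=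
    { toFun := fun t => (t : K →L[ℂ] K) M.vec
      map_add' := fun _ _ => rfl
      map_smul' := fun _ _ => rfl }
  let g : N.commutant.toStarSubalgebra →ₗ[ℂ] K :=
    { toFun := fun t => (t : K →L[ℂ] K) (T M.vec)
      map_add' := fun _ _ => rfl
      map_smul' := fun _ _ => rfl }
  have hf : DenseRange f := by
    suffices h : Set.range f = {η | ∃ t ∈ N.commutant, t M.vec = η} by
      rwa [DenseRange, h]
    ext η
    constructor
    · rintro ⟨t, rfl⟩
      exact ⟨t, t.2, rfl⟩
    · rintro ⟨t, ht, rfl⟩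
      exact ⟨⟨t, ht⟩, rfl⟩
  have hgf : ∀ t, ‖g t‖ ≤ ‖x‖ * ‖f t‖ := by
    intro t
    have ht : star (t : K →L[ℂ] K) * t ∈ N.commutant := mul_mem (star_mem t.2) t.2
    have hc := M.commute_compression hN hPs hPP hPN hPv hP hx ht
    have h1 := norm_apply_comp_le_of_commute ((t : K →L[ℂ] K) * P) T (by
      rw [star_mul, hPs]
      simpa only [hT, mul_assoc] using hc) M.vec
    simp only [mul_apply_eq_comp, hPv] at h1
    have h2 : P (T M.vec) = T M.vec := by rw [hTv, idem]
    rw [h2] at h1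
    exact h1.trans (mul_le_mul_of_nonneg_right hTx (norm_nonneg _))
  set e : K →L[ℂ] K := g.extendOfNorm f with he
  have hef : ∀ t ∈ N.commutant, e (t M.vec) = t (T M.vec) := fun t ht =>
    LinearMap.extendOfNorm_eq hf ⟨_, hgf⟩ (⟨t, ht⟩ : N.commutant.toStarSubalgebra)
  refine ⟨e, ?_, LinearMap.opNorm_extendOfNorm_le hf (norm_nonneg _) hgf, ?_⟩
  · rw [← VonNeumannAlgebra.commutant_commutant N, VonNeumannAlgebra.mem_commutant_iff]
    intro s hs
    ext ξ
    refine hcyc.induction (P := fun ξ => (s * e) ξ = (e * s) ξ) ?_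
      (isClosed_eq (by fun_prop) (by fun_prop)) ξ
    rintro _ ⟨t, ht, rfl⟩
    rw [mul_apply_eq_comp, mul_apply_eq_comp, hef t ht, mul_apply_eq_comp]
    exact (hef _ (mul_mem hs ht)).symm
  · rw [← hTv]
    exact hef 1 (one_mem _)

end TracialVN

end CondExp

/-! ### Leading powers of a generator in a free group. -/

namespace FreeGroup

variable {ι : Type*} [DecidableEq ι] (c : ι)

theorem toWord_mul_of_not_cancel {x y : FreeGroup ι}
    (h : ∀ l ∈ x.toWord.getLast?, ∀ r ∈ y.toWord.head?, l.1 = r.1 → l.2 = r.2) :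
    (x * y).toWord = x.toWord ++ y.toWord := by
  rw [toWord_mul]
  exact IsReduced.reduce_eq (List.isChain_append.2 ⟨isReduced_toWord, isReduced_toWord, h⟩)

/-- The reduced word of `u` does not begin with a power of the generator `c`. -/
def AvoidsHead (u : FreeGroup ι) : Prop := ∀ l ∈ u.toWord.head?, l.1 ≠ c

variable {c}

theorem AvoidsHead.one : AvoidsHead c (1 : FreeGroup ι) := by
  intro l hl
  simp at hl

theorem fst_eq_of_mem_toWord_zpow (p : ℤ) : ∀ l ∈ (of c ^ p).toWord, l.1 = c := by
  intro l hl
  cases p with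
  | ofNat n =>
    rw [Int.ofNat_eq_natCast, zpow_natCast, toWord_of_pow] at hl
    rw [List.eq_of_mem_replicate hl]
  | negSucc n =>
    rw [zpow_negSucc, toWord_inv, toWord_of_pow, invRev] at hl
    simp only [List.map_replicate, List.reverse_replicate] at hl
    rw [List.eq_of_mem_replicate hl]

theorem toWord_zpow_mul {u : FreeGroup ι} (hu : AvoidsHead c u) (p : ℤ) :
    (of c ^ p * u).toWord = (of c ^ p).toWord ++ u.toWord := by
  refine toWord_mul_of_not_cancel fun l hl r hr h => ?_
  refine absurd h.symm ?_
  rw [fst_eq_of_mem_toWord_zpow p l (List.mem_of_getLast? hl)]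
  exact hu r hr

theorem norm_zpow (p : ℤ) : ((of c ^ p).norm : ℤ) = |p| := by
  cases p with
  | ofNat n => simp
  | negSucc n =>
    rw [zpow_negSucc, norm_inv_eq, norm_of_pow]
    rw [abs_of_neg (Int.negSucc_lt_zero n), Int.neg_negSucc]

theorem of_zpow_eq_one {p : ℤ} (h : (of c) ^ p = 1) : p = 0 := by
  have h1 := norm_zpow (c := c) p
  rw [h, norm_one] at h1
  exact abs_eq_zero.1 h1.symm

/-- This is the uniqueness of the decomposition `w = c^p u`: no cancellation occurs in `c^p u`, so
for `p ≠ 0` its word still starts with a letter of `c`. -/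
theorem AvoidsHead.eq_zero_of_zpow_mul {u : FreeGroup ι} (hu : AvoidsHead c u) {p : ℤ}
    (h : AvoidsHead c (of c ^ p * u)) : p = 0 := by
  by_contra hp
  have h1 : (of c ^ p).toWord ≠ [] := by
    rw [Ne, toWord_eq_nil_iff]
    exact fun h0 => hp (of_zpow_eq_one h0)
  obtain ⟨l, L, hL⟩ := List.exists_cons_of_ne_nil h1
  refine h l ?_ (fst_eq_of_mem_toWord_zpow p l (by rw [hL]; exact List.mem_cons_self))
  rw [toWord_zpow_mul hu, hL]
  rfl

theorem exists_zpow_mul_mk (L : List (ι × Bool)) (hL : IsReduced L) :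
    ∃ (p : ℤ) (u : FreeGroup ι), AvoidsHead c u ∧ mk L = of c ^ p * u := by
  induction L with
  | nil => exact ⟨0, 1, AvoidsHead.one, by simp [one_eq_mk]⟩
  | cons l L ih =>
    by_cases hl : l.1 = c
    · obtain ⟨p, u, hu, h⟩ := ih (List.IsChain.tail hL)
      have e : mk (l :: L) = mk [l] * mk L := by rw [mul_mk]; rfl
      obtain ⟨l1, l2⟩ := l
      simp only at hl
      subst hl
      cases l2 with
      | true =>
        refine ⟨1 + p, u, hu, ?_⟩
        rw [e, h, zpow_add, zpow_one, mul_assoc]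
        rfl
      | false =>
        refine ⟨-1 + p, u, hu, ?_⟩
        rw [e, h, zpow_add, zpow_neg_one, mul_assoc]
        rfl
    · refine ⟨0, mk (l :: L), ?_, by simp⟩
      intro r hr
      rw [toWord_mk, hL.reduce_eq] at hr
      simp only [List.head?_cons, Option.mem_def, Option.some.injEq] at hr
      rwa [← hr]

variable (c) in
theorem exists_zpow_mul (w : FreeGroup ι) :
    ∃ (p : ℤ) (u : FreeGroup ι), AvoidsHead c u ∧ w = of c ^ p * u := by
  obtain ⟨p, u, hu, h⟩ := exists_zpow_mul_mk (c := c) w.toWord isReduced_toWord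
  exact ⟨p, u, hu, by rw [← h, mk_toWord]⟩

variable (c) in
/-- The exponent of the leading power of the generator `c` in the reduced word of `w`. -/
def lead (w : FreeGroup ι) : ℤ := (exists_zpow_mul c w).choose

theorem lead_zpow_mul {u : FreeGroup ι} (hu : AvoidsHead c u) (p : ℤ) :
    lead c (of c ^ p * u) = p := by
  obtain ⟨v, hv, h⟩ := (exists_zpow_mul c (of c ^ p * u)).choose_spec
  change of c ^ p * u = of c ^ lead c (of c ^ p * u) * v at h
  set q := lead c (of c ^ p * u)
  have h1 : v = of c ^ (p - q) * u := by
    rw [sub_eq_neg_add, zpow_add, mul_assoc, h, zpow_neg, inv_mul_cancel_left]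
  have h2 := hu.eq_zero_of_zpow_mul (h1 ▸ hv)
  lia

theorem AvoidsHead.lead_eq_zero {u : FreeGroup ι} (hu : AvoidsHead c u) : lead c u = 0 := by
  simpa using lead_zpow_mul hu 0

theorem lead_zpow_mul' (w : FreeGroup ι) (j : ℤ) : lead c (of c ^ j * w) = j + lead c w := by
  obtain ⟨p, u, hu, rfl⟩ := exists_zpow_mul c w
  rw [← mul_assoc, ← zpow_add, lead_zpow_mul hu, lead_zpow_mul hu]

/-- Right multiplication by a letter either appends it or deletes the last letter, so the head of a
nonempty word survives unless the word becomes empty. -/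
theorem AvoidsHead.mul_mk_singleton {u : FreeGroup ι} (hu : AvoidsHead c u) (h1 : u ≠ 1)
    (l : ι × Bool) : AvoidsHead c (u * mk [l]) := by
  have hne : u.toWord ≠ [] := by rwa [Ne, toWord_eq_nil_iff]
  have hw : (mk [l] : FreeGroup ι).toWord = [l] := by rw [toWord_mk, reduce_singleton]
  by_cases h : ∀ x ∈ u.toWord.getLast?, x.1 = l.1 → x.2 = l.2
  · intro r hr
    rw [toWord_mul_of_not_cancel (by simpa [hw] using h), List.head?_append_of_ne_nil _ hne] at hr
    exact hu r hr
  · push Not at h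
    obtain ⟨x, hx, hx1, hx2⟩ := h
    obtain ⟨U, hU⟩ : ∃ U, u.toWord = U ++ [x] := by
      refine ⟨u.toWord.dropLast, ?_⟩
      exact (List.dropLast_append_getLast? _ hx).symm
    have hred : IsReduced (U ++ [x]) := hU ▸ isReduced_toWord
    have e : u * mk [l] = mk U := by
      have h2 : u = mk U * mk [x] := by rw [mul_mk, ← hU, mk_toWord]
      have h3 : mk [x] * mk [l] = (1 : FreeGroup ι) := by
        rw [mul_mk, one_eq_mk]
        obtain ⟨x1, x2⟩ := x
        obtain ⟨l1, l2⟩ := l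
        simp only at hx1 hx2
        subst hx1
        have : l2 = !x2 := by cases x2 <;> cases l2 <;> simp_all
        rw [this]
        exact Quot.sound (Red.Step.not (L₁ := []) (L₂ := []))
      rw [h2, mul_assoc, h3, mul_one]
    intro r hr
    rw [e, toWord_mk, (hred.infix ⟨[], [x], by simp⟩).reduce_eq] at hr
    refine hu r ?_
    rw [hU]
    exact List.mem_head?_append_of_mem_head? hr

theorem avoidsHead_mk_singleton {l : ι × Bool} (h : l.1 ≠ c) : AvoidsHead c (mk [l]) := by
  intro r hr
  rw [toWord_mk, reduce_singleton] at hr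
  simp only [List.head?_cons, Option.mem_def, Option.some.injEq] at hr
  rwa [← hr]

/-- After splitting off the leading power, only an empty remainder can let the new letter change the
exponent. -/
theorem abs_lead_mul_mk_singleton (w : FreeGroup ι) (l : ι × Bool) :
    |lead c (w * mk [l])| ≤ |lead c w| + 1 := by
  obtain ⟨p, u, hu, rfl⟩ := exists_zpow_mul c w
  rw [mul_assoc, lead_zpow_mul', lead_zpow_mul hu]
  suffices h : |lead c (u * mk [l])| ≤ 1 from (abs_add_le _ _).trans (by lia)
  by_cases h1 : u = 1
  · rw [h1, one_mul]
    by_cases hl : l.1 = c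
    · obtain ⟨l1, l2⟩ := l
      simp only at hl
      subst hl
      have e : (mk [(l1, l2)] : FreeGroup ι) = of l1 ^ (if l2 then 1 else -1 : ℤ) * 1 := by
        cases l2
        · simp only [Bool.false_eq_true, if_false, zpow_neg_one, mul_one]
          rfl
        · simp only [if_true, zpow_one, mul_one]
          rfl
      rw [e, lead_zpow_mul AvoidsHead.one]
      cases l2 <;> simp
    · rw [(avoidsHead_mk_singleton hl).lead_eq_zero]
      simp
  · rw [(hu.mul_mk_singleton h1 l).lead_eq_zero]
    simp

theorem abs_lead_mul_le (w k : FreeGroup ι) : |lead c (w * k)| ≤ |lead c w| + k.norm := by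
  suffices h : ∀ L : List (ι × Bool), ∀ w, |lead c (w * mk L)| ≤ |lead c w| + L.length by
    have := h k.toWord w
    rwa [mk_toWord] at this
  intro L
  induction L with
  | nil => intro w; simp [← one_eq_mk]
  | cons l L ih =>
    intro w
    have e : mk (l :: L) = mk [l] * mk L := by rw [mul_mk]; rfl
    rw [e, ← mul_assoc]
    refine (ih _).trans ?_
    have := abs_lead_mul_mk_singleton (c := c) w l
    rw [List.length_cons]
    push_cast
    lia

/-- Since `u` is not a power of `c`, no partial product `u c^i` is trivial, so letters can be added
one at a time without touching the head. -/
theorem AvoidsHead.mul_zpow {u : FreeGroup ι} (hu : AvoidsHead c u)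
    (h1 : u ∉ Subgroup.zpowers (of c)) (j : ℤ) : AvoidsHead c (u * of c ^ j) := by
  have hne : ∀ i : ℤ, u * of c ^ i ≠ 1 := by
    intro i hi
    exact h1 ⟨-i, by rw [mul_eq_one_iff_eq_inv.1 hi]; simp⟩
  have hof : of c = mk [(c, true)] := rfl
  have hof' : (of c)⁻¹ = mk [(c, false)] := rfl
  induction j with
  | zero => simpa using hu
  | succ i ih =>
    rw [zpow_add_one, ← mul_assoc, hof]
    exact ih.mul_mk_singleton (hne _) _
  | pred i ih =>
    rw [zpow_sub_one, ← mul_assoc, hof']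
    exact ih.mul_mk_singleton (hne _) _

/-- The right factor `c^{-j}` cannot reach the leading power of a word outside `⟨c⟩`, so only the
left factor counts. -/
theorem lead_conj {w : FreeGroup ι} (h1 : w ∉ Subgroup.zpowers (of c)) (j : ℤ) :
    lead c (of c ^ j * w * (of c ^ j)⁻¹) = j + lead c w := by
  obtain ⟨p, u, hu, rfl⟩ := exists_zpow_mul c w
  have hu1 : u ∉ Subgroup.zpowers (of c) := fun h =>
    h1 (mul_mem (Subgroup.zpow_mem_zpowers _ _) h)
  rw [mul_assoc, mul_assoc, ← zpow_neg, lead_zpow_mul', lead_zpow_mul', lead_zpow_mul hu,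
    (hu.mul_zpow hu1 _).lead_eq_zero, add_zero]

/-- If `k` is not a power of `c` and `w` has a long leading power of `c`, then the leading power of
`k w k'` does not depend on `w`. -/
theorem lead_mul_mul {k : FreeGroup ι} (hk : k ∉ Subgroup.zpowers (of c)) (k' w : FreeGroup ι)
    (hw : |lead c k⁻¹| + k'.norm < |lead c w|) : lead c (k * w * k') = lead c k := by
  obtain ⟨i, v, hv, hkv⟩ := exists_zpow_mul c k⁻¹
  obtain ⟨q, u, hu, hku⟩ := exists_zpow_mul c k
  rw [hkv, lead_zpow_mul hv] at hw
  obtain ⟨p, t, ht, rfl⟩ := exists_zpow_mul c w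
  rw [lead_zpow_mul ht] at hw
  -- Right multiplication by `k'` may eat through `t` and expose a power of `c`, but its exponent is
  -- at most the length of `k'`.
  obtain ⟨p', t', ht', htk⟩ := exists_zpow_mul c (t * k')
  have hp' : |p'| ≤ k'.norm := by
    have := abs_lead_mul_le (c := c) t k'
    rwa [htk, lead_zpow_mul ht', ht.lead_eq_zero, abs_zero, zero_add] at this
  -- `k = c^q u₀ c^{-i}` with `u₀` neither beginning nor ending with a power of `c`
  set u₀ := u * of c ^ i with hu₀
  have hu1 : u ∉ Subgroup.zpowers (of c) := fun h =>
    hk (hku ▸ mul_mem (Subgroup.zpow_mem_zpowers _ _) h)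
  have hv1 : v ∉ Subgroup.zpowers (of c) := fun h =>
    hk (inv_mem_iff.1 (hkv ▸ mul_mem (Subgroup.zpow_mem_zpowers _ _) h))
  have hu₀a : AvoidsHead c u₀ := hu.mul_zpow hu1 i
  have hk0 : k = of c ^ q * u₀ * of c ^ (-i) := by
    rw [hu₀, hku, zpow_neg, mul_assoc, mul_inv_cancel_right]
  have hu₀inv : u₀⁻¹ = v * of c ^ q := by
    have h2 : u₀ = of c ^ (-q) * k * of c ^ i := by
      rw [hk0]; group
    rw [h2, mul_inv_rev, mul_inv_rev, hkv]; group
  have hu₀b : AvoidsHead c u₀⁻¹ := hu₀inv ▸ hv.mul_zpow hv1 q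
  have hu₀1 : u₀ ≠ 1 := by
    intro h
    exact hu1 ⟨-i, by rw [mul_eq_one_iff_eq_inv.1 h]; simp⟩
  -- All powers of `c` in the middle are collected. The length hypothesis on `w` makes the exponent
  -- `p - i + p'` nonzero, so this middle block shields `u₀` from `t'` and nothing further cancels.
  have e : k * (of c ^ p * t) * k' = of c ^ q * (u₀ * (of c ^ (p - i + p') * t')) := by
    calc k * (of c ^ p * t) * k' = of c ^ q * u₀ * of c ^ (-i) * (of c ^ p * (t * k')) := by
          rw [← hk0]; group
      _ = of c ^ q * u₀ * of c ^ (-i) * (of c ^ p * (of c ^ p' * t')) := by rw [htk]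
      _ = _ := by group
  have hne : p - i + p' ≠ 0 := by
    intro h
    have : p = i - p' := by lia
    rw [this] at hw
    have := abs_sub i p'
    lia
  rw [e, hku, lead_zpow_mul hu, lead_zpow_mul', AvoidsHead.lead_eq_zero, add_zero]
  intro r hr
  refine hu₀a r ?_
  rw [toWord_mul_of_not_cancel, List.head?_append_of_ne_nil] at hr
  · exact hr
  · rwa [Ne, toWord_eq_nil_iff]
  · intro l hl s hs h
    refine absurd h ?_
    have hs1 : s.1 = c := by
      rw [toWord_zpow_mul ht', List.head?_append_of_ne_nil] at hs
      · exact fst_eq_of_mem_toWord_zpow _ s (List.mem_of_mem_head? hs)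
      · rw [Ne, toWord_eq_nil_iff]
        exact fun h0 => hne (of_zpow_eq_one h0)
    rw [hs1]
    refine hu₀b (l.1, !l.2) ?_
    rw [toWord_inv, invRev, List.head?_reverse, List.getLast?_map]
    rw [Option.mem_def] at hl ⊢
    rw [hl]
    rfl

end FreeGroup

/-- `S` has arbitrarily many pairwise disjoint conjugates by elements of `H`. -/
def IsWandering {G : Type v} [Group G] (H : Subgroup G) (S : Set G) : Prop :=
  ∀ R : ℕ, ∃ t : Fin R → G, (∀ i, t i ∈ H) ∧
    Pairwise fun i j => ∀ g, t i * g * (t i)⁻¹ ∈ S → t j * g * (t j)⁻¹ ∉ S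

/-- The translates of `S` by `k` and `k'` are disjoint from each other and from the
cosets of `H` given by `k'`. -/
structure Separates {G : Type v} [Group G] (H : Subgroup G) (k k' : G) (S : Set G) : Prop where
  left_right : ∀ g ∈ S, ∀ g' ∈ S, k * g ≠ g' * k'
  left_coset_left : ∀ g ∈ S, ∀ h ∈ H, k * g ≠ k' * h
  left_coset_right : ∀ g ∈ S, ∀ h ∈ H, k * g ≠ h * k'
  right_coset_left : ∀ g ∈ S, ∀ h ∈ H, g * k ≠ k' * h
  right_coset_right : ∀ g ∈ S, ∀ h ∈ H, g * k ≠ h * k'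

/-! ### Separation of translates by long leading and trailing powers. -/

namespace FreeGroup

variable {ι : Type*} [DecidableEq ι] {c : ι}

theorem abs_lead_le_norm (w : FreeGroup ι) : |lead c w| ≤ w.norm := by
  have := abs_lead_mul_le (c := c) 1 w
  rwa [one_mul, AvoidsHead.one.lead_eq_zero, abs_zero, zero_add] at this

/-- For long `h` the exponent is that of `k` by `lead_mul_mul`; for `h = c^j` with `|j| ≤ |k| +
|k'|` it is bounded by the lengths, whence the factor 2. -/
theorem abs_lead_mul_zpow_mul_le {k : FreeGroup ι} (hk : k ∉ Subgroup.zpowers (of c))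
    (k' : FreeGroup ι) {h : FreeGroup ι} (hh : h ∈ Subgroup.zpowers (of c)) :
    |lead c (k * h * k')| ≤ 2 * (k.norm + k'.norm) := by
  obtain ⟨j, rfl⟩ := hh
  have h1 := abs_lead_le_norm (c := c) k
  have h2 := abs_lead_le_norm (c := c) k⁻¹
  rw [norm_inv_eq] at h2
  have h3 : lead c (of c ^ j) = j := by simpa using lead_zpow_mul AvoidsHead.one (c := c) j
  by_cases hw : |lead c k⁻¹| + k'.norm < |lead c (of c ^ j)|
  · rw [lead_mul_mul hk k' _ hw]
    lia
  · rw [h3] at hw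
    have h4 := abs_lead_mul_le (c := c) k (of c ^ j * k')
    have h5 := norm_mul_le (of c ^ j) k'
    have h6 := norm_zpow (c := c) j
    rw [← mul_assoc] at h4
    change |lead c (k * of c ^ j * k')| ≤ _
    lia

variable (c) in
/-- The elements with long leading and trailing powers of the generator `c`. -/
def longEnds (m : ℕ) : Set (FreeGroup ι) :=
  {w | w ∉ Subgroup.zpowers (of c) ∧ m < |lead c w| ∧ m < |lead c w⁻¹|}

/-- If `k g = g' k'`, then `g' = k g k'⁻¹` has the short leading power of `k`. In the coset cases
`g` lies in `k⁻¹k'⟨c⟩`, `k⁻¹⟨c⟩k'`, `k'⟨c⟩k⁻¹` or `⟨c⟩k'k⁻¹`. The first three have bounded leading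
exponents; in the last the leading power is arbitrary and the trailing one is used, by passing to
`g⁻¹`. -/
theorem separates_longEnds {k k' : FreeGroup ι} (hk : k ∉ Subgroup.zpowers (of c))
    (hk' : k' ∉ Subgroup.zpowers (of c)) :
    Separates (Subgroup.zpowers (of c)) k k' (longEnds c (2 * (k.norm + k'.norm))) where
  left_right := by
    rintro g ⟨-, hg, -⟩ g' ⟨-, hg', -⟩ h
    have e : g' = k * g * k'⁻¹ := by rw [h, mul_inv_cancel_right]
    have h1 := abs_lead_le_norm (c := c) k
    have h2 := abs_lead_le_norm (c := c) k⁻¹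
    rw [norm_inv_eq] at h2
    rw [e, lead_mul_mul hk k'⁻¹ g (by rw [norm_inv_eq]; push_cast at hg; lia)] at hg'
    push_cast at hg'
    lia
  left_coset_left := by
    rintro g ⟨hgc, hg, -⟩ h hh e
    have e1 : g = k⁻¹ * k' * h := by rw [mul_assoc, ← e, inv_mul_cancel_left]
    have hr : k⁻¹ * k' ∉ Subgroup.zpowers (of c) := fun hr => hgc (e1 ▸ mul_mem hr hh)
    have h1 := abs_lead_mul_zpow_mul_le hr 1 hh
    have h2 := norm_mul_le k⁻¹ k'
    rw [norm_inv_eq] at h2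
    rw [mul_one, ← e1, norm_one] at h1
    push_cast at hg h1
    lia
  left_coset_right := by
    rintro g ⟨hgc, hg, -⟩ h hh e
    have e1 : g = k⁻¹ * h * k' := by rw [mul_assoc, ← e, inv_mul_cancel_left]
    have h1 := abs_lead_mul_zpow_mul_le (fun h => hk (inv_mem_iff.1 h)) k' hh
    rw [← e1, norm_inv_eq] at h1
    push_cast at hg
    lia
  right_coset_left := by
    rintro g ⟨hgc, hg, -⟩ h hh e
    have e1 : g = k' * h * k⁻¹ := by rw [← e, mul_inv_cancel_right]
    have h1 := abs_lead_mul_zpow_mul_le hk' k⁻¹ hh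
    rw [← e1, norm_inv_eq] at h1
    push_cast at hg
    lia
  right_coset_right := by
    rintro g ⟨hgc, -, hg⟩ h hh e
    have e1 : g⁻¹ = k * k'⁻¹ * h⁻¹ := by
      rw [eq_mul_inv_of_mul_eq e]; group
    have hr : k * k'⁻¹ ∉ Subgroup.zpowers (of c) := fun hr =>
      hgc (inv_mem_iff.1 (e1 ▸ mul_mem hr (inv_mem hh)))
    have h1 := abs_lead_mul_zpow_mul_le hr 1 (inv_mem hh)
    have h2 := norm_mul_le k k'⁻¹
    rw [norm_inv_eq] at h2
    rw [mul_one, ← e1, norm_one] at h1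
    push_cast at hg h1
    lia

end FreeGroup

/-! ### Wandering sets and separation in the product of free groups. -/

section FreeProd

open FreeGroup

variable {N : ℕ} {n : Fin N → ℕ} (hn : ∀ i, 2 ≤ n i) (i : Fin N)

theorem conj_mulSingle_apply (w : FreeGroup (Fin (n i))) (g : FreeProd n) :
    ((Pi.mulSingle i w : FreeProd n) * g * (Pi.mulSingle i w : FreeProd n)⁻¹) i =
      w * g i * w⁻¹ := by
  simp

/-- Bounding the exponent of the leading power of the first generator (of the element or of its
inverse, according to `φ`) in the `i`-th coordinate gives a wandering set. -/
theorem isWandering_lead_le (φ : FreeGroup (Fin (n i)) → ℤ) (m : ℕ)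
    (hφ : ∀ w ∉ firstSubgroup (n i) (hn i), ∀ j : ℤ,
      φ (of ⟨0, by have := hn i; omega⟩ ^ j * w * (of ⟨0, by have := hn i; omega⟩ ^ j)⁻¹) =
        j + φ w) :
    IsWandering (subH n hn) {g | g i ∉ firstSubgroup (n i) (hn i) ∧ |φ (g i)| ≤ m} := by
  intro R
  set c : Fin (n i) := ⟨0, by have := hn i; omega⟩
  have hc : ∀ j : ℤ, of c ^ j ∈ firstSubgroup (n i) (hn i) := fun j =>
    Subgroup.zpow_mem_zpowers _ _
  -- The window `[-m, m]` contains `2m + 1` integers, so its shifts by distinct multiples of `2m +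
  -- 1` are disjoint.
  refine ⟨fun r => Pi.mulSingle i (of c ^ ((r : ℤ) * (2 * m + 1))), fun r => ?_, ?_⟩
  · intro j _
    change (Pi.mulSingle i (of c ^ ((r : ℤ) * (2 * m + 1))) : FreeProd n) j ∈
      firstSubgroup (n j) (hn j)
    by_cases h : j = i
    · subst h
      rw [Pi.mulSingle_eq_same]
      exact hc _
    · rw [Pi.mulSingle_eq_of_ne h]
      exact one_mem _
  · intro r r' hrr g hg hg'
    simp only [Set.mem_ofPred_eq, conj_mulSingle_apply] at hg hg'
    have hgi : g i ∉ firstSubgroup (n i) (hn i) := fun h =>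
      hg.1 (mul_mem (mul_mem (hc _) h) (inv_mem (hc _)))
    rw [hφ _ hgi] at hg hg'
    obtain ⟨h1, h2⟩ := abs_le.1 hg.2
    obtain ⟨h3, h4⟩ := abs_le.1 hg'.2
    have hne : (r : ℤ) ≠ r' := fun h => hrr (Fin.ext (by exact_mod_cast h))
    rcases lt_or_gt_of_ne hne with h | h
    · nlinarith
    · nlinarith

/-- Outside of `G_i`, pairs of translations are separated by the complement of the union of `G_i`
with two wandering sets. -/
theorem exists_wandering_separates {k k' : FreeProd n} (hk : k ∉ subG n hn i)
    (hk' : k' ∉ subG n hn i) :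
    ∃ B₁ B₂ : Set (FreeProd n), IsWandering (subH n hn) B₁ ∧ IsWandering (subH n hn) B₂ ∧
      Separates (subH n hn) k k' {g | g ∉ subG n hn i ∧ g ∉ B₁ ∧ g ∉ B₂} := by
  set c : Fin (n i) := ⟨0, by have := hn i; omega⟩ with hc
  set m := 2 * ((k i).norm + (k' i).norm) with hm
  have hsep := separates_longEnds (c := c) (k := k i) (k' := k' i) hk hk'
  -- The two sets bound the leading and the trailing power respectively. The trailing one is the
  -- leading power of the inverse, which conjugation by `c^j` also shifts by `j`.
  refine ⟨_, _, isWandering_lead_le hn i (fun w => lead c w) m fun w hw j => lead_conj hw j,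
    isWandering_lead_le hn i (fun w => lead c w⁻¹) m fun w hw j => ?_, ?_⟩
  · rw [mul_inv_rev, mul_inv_rev, inv_inv, ← mul_assoc]
    exact lead_conj (fun h => hw (inv_mem_iff.1 h)) j
  have hS : ∀ g ∈ {g : FreeProd n | g ∉ subG n hn i ∧
      g ∉ {g | g i ∉ firstSubgroup (n i) (hn i) ∧ |lead c (g i)| ≤ m} ∧
      g ∉ {g | g i ∉ firstSubgroup (n i) (hn i) ∧ |lead c (g i)⁻¹| ≤ m}},
      g i ∈ longEnds c m := by
    rintro g ⟨h1, h2, h3⟩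
    have h1' : g i ∉ firstSubgroup (n i) (hn i) := h1
    simp only [Set.mem_ofPred_eq, h1', not_false_eq_true, true_and, not_le] at h2 h3
    exact ⟨h1, h2, h3⟩
  have hH : ∀ h ∈ subH n hn, h i ∈ Subgroup.zpowers (of c) := fun h hh => hh i (Set.mem_univ i)
  constructor
  · exact fun g hg g' hg' e => hsep.left_right _ (hS g hg) _ (hS g' hg') (congrFun e i)
  · exact fun g hg h hh e => hsep.left_coset_left _ (hS g hg) _ (hH h hh) (congrFun e i)
  · exact fun g hg h hh e => hsep.left_coset_right _ (hS g hg) _ (hH h hh) (congrFun e i)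
  · exact fun g hg h hh e => hsep.right_coset_left _ (hS g hg) _ (hH h hh) (congrFun e i)
  · exact fun g hg h hh e => hsep.right_coset_right _ (hS g hg) _ (hH h hh) (congrFun e i)

theorem subH_le_subG : subH n hn ≤ subG n hn i := fun _ hh => hh i (Set.mem_univ i)

end FreeProd

/-! ### Conditional expectations on the algebra and on its ultrapower. -/

namespace TracialVN

variable {K : Type u} [NormedAddCommGroup K] [InnerProductSpace ℂ K] [CompleteSpace K]
  (M : TracialVN K) (ω : Ultrafilter ℕ)

/-- `B` is a self-adjoint subspace of `M` whose trace preserving conditional expectation exists,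
is contractive, and is implemented by the self-adjoint operator `P`. -/
structure HasExpectation (B : Set ↥M.alg) (P : K →L[ℂ] K) : Prop where
  star_proj : star P = P
  sub_mem : ∀ a ∈ B, ∀ b ∈ B, a - b ∈ B
  star_mem : ∀ a ∈ B, star a ∈ B
  proj_vec : ∀ b ∈ B, P ((b : K →L[ℂ] K) M.vec) = (b : K →L[ℂ] K) M.vec
  exists_mem : ∀ x : ↥M.alg, ∃ e ∈ B, ‖e‖ ≤ ‖x‖ ∧
    (e : K →L[ℂ] K) M.vec = P ((x : K →L[ℂ] K) M.vec)

variable {M}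

namespace HasExpectation

variable {B : Set ↥M.alg} {P : K →L[ℂ] K} (hB : M.HasExpectation B P)

include hB

theorem trace_mul {x e : ↥M.alg} (he : (e : K →L[ℂ] K) M.vec = P ((x : K →L[ℂ] K) M.vec))
    {b : ↥M.alg} (hb : b ∈ B) : M.trace (e * b) = M.trace (x * b) := by
  rw [M.trace_mul_comm, M.trace_mul_comm x, ← star_star b, M.trace_star_mul, M.trace_star_mul, he,
    ← inner_star_apply, hB.star_proj, hB.proj_vec _ (hB.star_mem b hb)]

/-- Two candidates `f`, `e` have the same trace pairings with `B`; pairing with `(f - e)*` forces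
`(f - e) vec = 0`. Hence the chosen element has the vector given by `P`. -/
theorem condE_vec (x : ↥M.alg) :
    (M.condE B x : K →L[ℂ] K) M.vec = P ((x : K →L[ℂ] K) M.vec) := by
  obtain ⟨e, heB, -, he⟩ := hB.exists_mem x
  have hex : ∃ e ∈ B, ∀ b ∈ B, M.trace (e * b) = M.trace (x * b) :=
    ⟨e, heB, fun b hb => hB.trace_mul he hb⟩
  have hc : M.condE B x = hex.choose := dif_pos hex
  obtain ⟨h1, h2⟩ := hex.choose_spec
  rw [← hc] at h1 h2
  set f := M.condE B x
  have hd : f - e ∈ B := hB.sub_mem _ h1 _ heB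
  have h3 : M.trace ((f - e) * star (f - e)) = 0 := by
    rw [sub_mul, trace_sub, h2 _ (hB.star_mem _ hd), hB.trace_mul he (hB.star_mem _ hd), sub_self]
  rw [M.trace_mul_comm, M.trace_star_mul_self] at h3
  have h4 : ((f - e : ↥M.alg) : K →L[ℂ] K) M.vec = 0 := by
    rw [← norm_eq_zero, ← sq_eq_zero_iff]
    exact_mod_cast h3
  rw [← he]
  exact sub_eq_zero.1 h4

end HasExpectation

theorem ofSeq_eq_iff {x y : M.BddSeq} : M.ofSeq ω x = M.ofSeq ω y ↔
    Tendsto (fun k => ‖(x k : K →L[ℂ] K) M.vec - (y k : K →L[ℂ] K) M.vec‖) ω (𝓝 0) := by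
  rw [ofSeq, ofSeq, Ideal.Quotient.eq, mem_nullIdeal_iff]
  rfl

theorem tendsto_norm_sq (x : M.BddSeq) :
    Tendsto (fun k => ‖(x k : K →L[ℂ] K) M.vec‖ ^ 2) ω (𝓝 (M.ultraNorm2 ω (M.ofSeq ω x) ^ 2)) := by
  have h := M.tendsto_ultraTrace ω (star x * x)
  have h1 := (Complex.continuous_re.tendsto _).comp h
  have h2 : Tendsto (fun k => ‖(x k : K →L[ℂ] K) M.vec‖ ^ 2) ω
      (𝓝 (M.ultraTrace ω (M.ofSeq ω (star x * x))).re) := by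
    refine h1.congr fun k => ?_
    change (M.trace (star (x k) * x k)).re = _
    rw [M.trace_star_mul_self, Complex.ofReal_re]
  have h3 : 0 ≤ (M.ultraTrace ω (M.ofSeq ω (star x * x))).re :=
    ge_of_tendsto' h2 fun k => by positivity
  have e : M.ultraNorm2 ω (M.ofSeq ω x) ^ 2 =
      (M.ultraTrace ω (M.ofSeq ω (star x * x))).re := by
    rw [ultraNorm2, norm2, star_ofSeq, ← map_mul, Real.sq_sqrt h3]
  rwa [e]

/-- Expectations taken entrywise stay bounded by contractivity, so they define a class in `B^ω` with
the required trace pairings. Uniqueness, from faithfulness of `τ_ω`, identifies it with the chosen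
expectation. -/
theorem HasExpectation.ultraCondE_ofSeq {B : Set ↥M.alg} {P : K →L[ℂ] K}
    (hB : M.HasExpectation B P) (x : M.BddSeq) :
    ∃ e : M.BddSeq, (∀ k, e k ∈ B) ∧
      (∀ k, (e k : K →L[ℂ] K) M.vec = P ((x k : K →L[ℂ] K) M.vec)) ∧
      M.ultraCondE ω B (M.ofSeq ω x) = M.ofSeq ω e := by
  choose E hEB hEn hE using hB.exists_mem
  let e : M.BddSeq := ⟨fun k => E (x k), memℓp_infty ⟨‖x‖, by
    rintro _ ⟨k, rfl⟩
    exact (hEn _).trans (lp.norm_apply_le_norm ENNReal.top_ne_zero x k)⟩⟩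
  refine ⟨e, fun k => hEB _, fun k => hE _, ?_⟩
  have hmem : M.ofSeq ω e ∈ M.subUltrapower ω B := ⟨e, fun k => hEB _, rfl⟩
  have htr : ∀ b ∈ M.subUltrapower ω B, M.ultraTrace ω (M.ofSeq ω e * b) =
      M.ultraTrace ω (M.ofSeq ω x * b) := by
    rintro _ ⟨b, hb, rfl⟩
    rw [← map_mul, ← map_mul]
    refine tendsto_nhds_unique (M.tendsto_ultraTrace ω (e * b)) ?_
    refine (M.tendsto_ultraTrace ω (x * b)).congr fun k => ?_
    exact (hB.trace_mul (hE (x k)) (hb k)).symm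
  have hex : ∃ e ∈ M.subUltrapower ω B, ∀ b ∈ M.subUltrapower ω B,
      M.ultraTrace ω (e * b) = M.ultraTrace ω (M.ofSeq ω x * b) := ⟨_, hmem, htr⟩
  have hc : M.ultraCondE ω B (M.ofSeq ω x) = hex.choose := dif_pos hex
  obtain ⟨⟨f, hfB, hf⟩, h2⟩ := hex.choose_spec
  rw [← hc] at hf h2
  rw [← hf] at h2 ⊢
  have hd : ∀ k, star (f - e) k ∈ B := fun k => hB.star_mem _ (hB.sub_mem _ (hfB k) _ (hEB _))
  have h3 : M.ultraTrace ω (M.ofSeq ω f * M.ofSeq ω (star (f - e))) =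
      M.ultraTrace ω (M.ofSeq ω e * M.ofSeq ω (star (f - e))) := by
    rw [h2 _ ⟨_, hd, rfl⟩, htr _ ⟨_, hd, rfl⟩]
  rw [← map_mul, ← map_mul] at h3
  have h4 := (M.tendsto_ultraTrace ω (f * star (f - e))).sub
    (M.tendsto_ultraTrace ω (e * star (f - e)))
  rw [h3, sub_self] at h4
  change M.ofSeq ω f = M.ofSeq ω e
  rw [ofSeq_eq_iff]
  have h5 : Tendsto (fun k => ‖(f k : K →L[ℂ] K) M.vec - (e k : K →L[ℂ] K) M.vec‖ ^ 2) ω (𝓝 0) := by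
    have h6 := (Complex.continuous_re.tendsto _).comp h4
    rw [Complex.zero_re] at h6
    refine h6.congr fun k => ?_
    change (M.trace (f k * star (f k - e k)) - M.trace (e k * star (f k - e k))).re = _
    rw [← trace_sub, ← sub_mul, M.trace_mul_comm, M.trace_star_mul_self, Complex.ofReal_re]
    rfl
  simpa [Function.comp_def] using (Real.continuous_sqrt.tendsto _).comp h5

end TracialVN

/-! ### Coordinate projections and expectations in the crossed product. -/

namespace CrossedProduct

variable {M₀ : Type u} [CStarAlgebra M₀] [PartialOrder M₀] [StarOrderedRing M₀] (τ₀ : M₀ →ₚ[ℂ] ℂ)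
  {G : Type v} [Group G] (α : G →* (M₀ ≃⋆ₐ[ℂ] M₀))

open Classical in
/-- The projection of `ℓ²(G, L²(M₀))` onto `ℓ²(S, L²(M₀))`. -/
def chi (S : Set G) : Space τ₀ α →L[ℂ] Space τ₀ α :=
  weightedOp (Equiv.refl G) (fun g => if g ∈ S then 1 else 0) 1 fun g => by
    split_ifs
    · exact ContinuousLinearMap.norm_id_le
    · simp

open Classical in
theorem chi_apply (S : Set G) (ξ : Space τ₀ α) (g : G) :
    chi τ₀ α S ξ g = if g ∈ S then ξ g else 0 := by
  rw [chi, weightedOp_apply]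
  split_ifs <;> rfl

variable {τ₀ α} in
theorem chi_apply_of_mem {S : Set G} {g : G} (h : g ∈ S) (ξ : Space τ₀ α) :
    chi τ₀ α S ξ g = ξ g := by
  rw [chi_apply, if_pos h]

variable {τ₀ α} in
theorem chi_apply_of_notMem {S : Set G} {g : G} (h : g ∉ S) (ξ : Space τ₀ α) :
    chi τ₀ α S ξ g = 0 := by
  rw [chi_apply, if_neg h]

theorem star_chi (S : Set G) : star (chi τ₀ α S) = chi τ₀ α S := by
  symm
  rw [ContinuousLinearMap.star_eq_adjoint, ContinuousLinearMap.eq_adjoint_iff]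
  intro ξ η
  rw [lp.inner_eq_tsum, lp.inner_eq_tsum]
  congr 1
  ext g
  by_cases h : g ∈ S
  · rw [chi_apply_of_mem h, chi_apply_of_mem h]
  · rw [chi_apply_of_notMem h, chi_apply_of_notMem h, inner_zero_left, inner_zero_right]

theorem chi_mul_self (S : Set G) : chi τ₀ α S * chi τ₀ α S = chi τ₀ α S := by
  ext ξ g
  rw [mul_apply_eq_comp]
  by_cases h : g ∈ S
  · rw [chi_apply_of_mem h]
  · rw [chi_apply_of_notMem h, chi_apply_of_notMem h]

theorem incl_chi (S : Set G) (a : M₀) : incl τ₀ α a * chi τ₀ α S = chi τ₀ α S * incl τ₀ α a := by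
  ext ξ g
  simp only [mul_apply_eq_comp, incl_apply]
  by_cases h : g ∈ S
  · rw [chi_apply_of_mem h, chi_apply_of_mem h, incl_apply]
  · rw [chi_apply_of_notMem h, chi_apply_of_notMem h, map_zero]

theorem lam_chi {L : Subgroup G} {s : G} (hs : s ∈ L) :
    lam τ₀ α s * chi τ₀ α L = chi τ₀ α L * lam τ₀ α s := by
  ext ξ g
  simp only [mul_apply_eq_comp, lam_apply]
  have hiff : s⁻¹ * g ∈ (L : Set G) ↔ g ∈ (L : Set G) := L.mul_mem_cancel_left (inv_mem hs)
  by_cases h : g ∈ (L : Set G)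
  · rw [chi_apply_of_mem h, chi_apply_of_mem (hiff.2 h), lam_apply]
  · rw [chi_apply_of_notMem h, chi_apply_of_notMem (mt hiff.1 h)]

theorem incl_mem_vn (L : Subgroup G) (a : M₀) : incl τ₀ α a ∈ vn τ₀ α L :=
  mem_vnGenerated_iff.2 fun _ ht => ((ht _ (Or.inl ⟨a, rfl⟩)).1).symm

theorem lam_mem_vn {L : Subgroup G} {s : G} (hs : s ∈ L) : lam τ₀ α s ∈ vn τ₀ α L :=
  mem_vnGenerated_iff.2 fun _ ht => ((ht _ (Or.inr ⟨s, hs, rfl⟩)).1).symm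

theorem vn_mono {L L' : Subgroup G} (h : L ≤ L') {x : Space τ₀ α →L[ℂ] Space τ₀ α}
    (hx : x ∈ vn τ₀ α L) : x ∈ vn τ₀ α L' :=
  mem_vnGenerated_iff.2 fun t ht => mem_vnGenerated_iff.1 hx t fun s hs =>
    ht s (hs.imp id fun ⟨g, hg, e⟩ => ⟨g, h hg, e⟩)

theorem chi_comm_of_mem {L : Subgroup G} {x : Space τ₀ α →L[ℂ] Space τ₀ α} (hx : x ∈ vn τ₀ α L) :
    chi τ₀ α L * x = x * chi τ₀ α L := by
  refine mem_vnGenerated_iff.1 hx _ ?_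
  rintro _ (⟨a, rfl⟩ | ⟨s, hs, rfl⟩)
  · exact ⟨incl_chi τ₀ α L a, by rw [star_incl, incl_chi]⟩
  · exact ⟨lam_chi τ₀ α hs, by rw [star_lam, lam_chi τ₀ α (inv_mem hs)]⟩

open Classical in
/-- A closed subgroup containing the vectors `δ_g ⊗ b` with `g ∈ S` contains `ℓ²(S, L²(M₀))`. -/
theorem chi_mem_of_single (V : AddSubgroup (Space τ₀ α)) (hV : IsClosed (V : Set (Space τ₀ α)))
    (S : Set G) (h : ∀ g ∈ S, ∀ b, (lp.single 2 g (gnsVec τ₀ b) : Space τ₀ α) ∈ V)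
    (ξ : Space τ₀ α) : chi τ₀ α S ξ ∈ V := by
  have h1 : ∀ g ∈ S, ∀ ζ : τ₀.GNS, (lp.single 2 g ζ : Space τ₀ α) ∈ V := by
    intro g hg ζ
    induction ζ using gns_induction with
    | hp => exact hV.preimage (lp.isometry_single g).continuous
    | h b => exact h g hg b
  have h2 := lp.hasSum_single (by norm_num) (chi τ₀ α S ξ)
  refine hV.mem_of_tendsto h2 (Eventually.of_forall fun s => V.sum_mem fun g _ => ?_)
  by_cases hg : g ∈ S
  · exact h1 g hg _
  · rw [chi_apply_of_notMem hg]
    convert V.zero_mem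
    exact map_zero (lp.singleAddMonoidHom 2 g)

open Classical in
theorem single_eq_incl_lam (g : G) (b : M₀) :
    (lp.single 2 g (gnsVec τ₀ b) : Space τ₀ α) =
      (incl τ₀ α (α g b) * lam τ₀ α g) (vec τ₀ α) := by
  ext h
  rw [mul_apply_eq_comp, incl_apply, lam_apply, vec]
  by_cases hg : h = g
  · subst hg
    rw [lp.single_apply_self, inv_mul_cancel, lp.single_apply_self, gnsStarAlgHom_gnsVec, mul_one,
      ← StarAlgEquiv.mul_apply, ← map_mul]
    simp
  · rw [lp.single_apply_ne _ _ _ hg, lp.single_apply_ne, map_zero]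
    rwa [Ne, inv_mul_eq_one, eq_comm]

variable (hτ₀ : IsFaithfulNormalTracialState τ₀) (hα : ∀ g a, τ₀ (α g a) = τ₀ a)

theorem chi_univ (ξ : Space τ₀ α) : chi τ₀ α Set.univ ξ = ξ := by
  ext g
  exact chi_apply_of_mem (Set.mem_univ g) ξ

theorem chi_vec (L : Subgroup G) : chi τ₀ α L (vec τ₀ α) = vec τ₀ α := by
  classical
  ext g
  by_cases hg : g ∈ (L : Set G)
  · rw [chi_apply_of_mem hg]
  · rw [chi_apply_of_notMem hg, vec, lp.single_apply_ne]
    rintro rfl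
    exact hg L.one_mem

theorem chi_mem_closure (L : Subgroup G) (ξ : Space τ₀ α) :
    chi τ₀ α L ξ ∈ closure {η | ∃ b ∈ vn τ₀ α L, b (vec τ₀ α) = η} := by
  let V : Submodule ℂ (Space τ₀ α) :=
    (vn τ₀ α L).toStarSubalgebra.toSubalgebra.toSubmodule.map
      (LinearMap.applyₗ' ℂ (vec τ₀ α) ∘ₗ ContinuousLinearMap.coeLM ℂ)
  have hV : (V : Set (Space τ₀ α)) = {η | ∃ b ∈ vn τ₀ α L, b (vec τ₀ α) = η} := rfl
  rw [← hV, ← Submodule.topologicalClosure_coe]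
  refine chi_mem_of_single τ₀ α V.topologicalClosure.toAddSubgroup V.isClosed_topologicalClosure _ (fun g hg b => ?_) ξ
  refine V.le_topologicalClosure ?_
  rw [single_eq_incl_lam]
  have hm : incl τ₀ α (α g b) * lam τ₀ α g ∈ vn τ₀ α L :=
    mul_mem (incl_mem_vn τ₀ α L _) (lam_mem_vn τ₀ α hg)
  exact ⟨_, hm, rfl⟩

include hτ₀ hα in
-- Right multiplications commute with the whole crossed product and already carry `vec` to every
-- `δ_g ⊗ b`.
theorem dense_commutant_vec (L : Subgroup G) :
    Dense {η | ∃ t ∈ (vn τ₀ α L).commutant, t (vec τ₀ α) = η} := by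
  let V : Submodule ℂ (Space τ₀ α) :=
    (vn τ₀ α L).commutant.toStarSubalgebra.toSubalgebra.toSubmodule.map
      (LinearMap.applyₗ' ℂ (vec τ₀ α) ∘ₗ ContinuousLinearMap.coeLM ℂ)
  have hV : (V : Set (Space τ₀ α)) = {η | ∃ b ∈ (vn τ₀ α L).commutant, b (vec τ₀ α) = η} := rfl
  intro ξ
  rw [← hV, ← Submodule.topologicalClosure_coe, ← chi_univ τ₀ α ξ]
  refine chi_mem_of_single τ₀ α V.topologicalClosure.toAddSubgroup V.isClosed_topologicalClosure _ (fun g hg b => ?_) ξ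
  refine V.le_topologicalClosure ?_
  rw [single_eq τ₀ α hτ₀ hα]
  have hm : rightLam τ₀ α hα g⁻¹ * right τ₀ α hτ₀ (α g b) ∈ (vn τ₀ α L).commutant := by
    refine mul_mem ?_ ?_
    · exact VonNeumannAlgebra.mem_commutant_iff.2 fun x hx =>
        (rightLam_comm_of_mem τ₀ α hα (vn_mono τ₀ α le_top hx) _).symm
    · exact VonNeumannAlgebra.mem_commutant_iff.2 fun x hx =>
        (right_comm_of_mem τ₀ α hτ₀ (vn_mono τ₀ α le_top hx) _).symm
  exact ⟨_, hm, rfl⟩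

/-- This turns conditions on expectations into conditions on supports: `E_{M_L}` acts on vectors as
restriction to `L`. -/
theorem hasExpectation_crossedSub (L : Subgroup G) :
    (crossedProduct τ₀ hτ₀ α hα).HasExpectation (crossedSub τ₀ hτ₀ α hα L) (chi τ₀ α L) where
  star_proj := star_chi τ₀ α L
  sub_mem := fun a ha b hb => sub_mem (S := VonNeumannAlgebra (Space τ₀ α)) (H := vn τ₀ α L) ha hb
  star_mem := fun a ha => (vn τ₀ α L).star_mem' ha
  proj_vec := fun b hb => by
    have := DFunLike.congr_fun (chi_comm_of_mem τ₀ α hb) (vec τ₀ α)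
    rw [mul_apply_eq_comp, mul_apply_eq_comp, chi_vec] at this
    exact this
  exists_mem := fun x => by
    obtain ⟨e, he, h1, h2⟩ := (crossedProduct τ₀ hτ₀ α hα).exists_expectation
      (N := vn τ₀ α L) (fun x hx => vn_mono τ₀ α le_top hx) (star_chi τ₀ α L)
      (chi_mul_self τ₀ α L) (fun b hb => chi_comm_of_mem τ₀ α hb) (chi_vec τ₀ α L)
      (chi_mem_closure τ₀ α L) (dense_commutant_vec τ₀ α hτ₀ hα L) x.2
    exact ⟨⟨e, vn_mono τ₀ α le_top he⟩, he, h1, h2⟩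

end CrossedProduct

/-! ### Hilbert space estimates and approximation in the 2-norm. -/

section Hilbert

variable {K : Type u} [NormedAddCommGroup K] [InnerProductSpace ℂ K]

/-- The square is expanded and only `‖c - d‖² ≥ 0` is dropped. In the application `a, b, c, d` are
the vectors of `yZ, Zy, ye, ey`. -/
theorem norm_sq_add_norm_sq_le (a b c d : K) :
    ‖a‖ ^ 2 + ‖b‖ ^ 2 + 2 * (-⟪a, b⟫_ℂ + ⟪a, c⟫_ℂ - ⟪a, d⟫_ℂ - ⟪b, c⟫_ℂ + ⟪b, d⟫_ℂ).re ≤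
      ‖a - b + (c - d)‖ ^ 2 := by
  have h1 := @norm_add_sq ℂ K _ _ _ (a - b) (c - d)
  have h2 := @norm_sub_sq ℂ K _ _ _ a b
  have h3 := sq_nonneg ‖c - d‖
  simp only [inner_sub_left, inner_sub_right, map_sub, RCLike.re_to_complex] at h1 h2
  simp only [Complex.add_re, Complex.sub_re, Complex.neg_re]
  linarith

/-- Bounded operators applied to asymptotically equal bounded sequences have asymptotically equal
inner products. -/
theorem tendsto_inner_of_approx {l : Filter ℕ} (S T : K →L[ℂ] K) {ξ ξ' η η' : ℕ → K} {C D : ℝ}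
    (hξ : ∀ k, ‖ξ k‖ ≤ C) (hη' : ∀ k, ‖η' k‖ ≤ D)
    (hξξ : Tendsto (fun k => ‖ξ k - ξ' k‖) l (𝓝 0)) (hηη : Tendsto (fun k => ‖η k - η' k‖) l (𝓝 0))
    (h0 : ∀ k, ⟪S (ξ' k), T (η' k)⟫_ℂ = 0) :
    Tendsto (fun k => ⟪S (ξ k), T (η k)⟫_ℂ) l (𝓝 0) := by
  have e : ∀ k, ⟪S (ξ k), T (η k)⟫_ℂ =
      ⟪S (ξ k), T (η k - η' k)⟫_ℂ + ⟪S (ξ k - ξ' k), T (η' k)⟫_ℂ := by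
    intro k
    rw [map_sub, map_sub, inner_sub_right, inner_sub_left, h0]
    ring
  have hlim : Tendsto (fun k => ‖S‖ * C * ‖T‖ * ‖η k - η' k‖ + ‖S‖ * ‖T‖ * D * ‖ξ k - ξ' k‖) l
      (𝓝 0) := by
    simpa using (hηη.const_mul (‖S‖ * C * ‖T‖)).add (hξξ.const_mul (‖S‖ * ‖T‖ * D))
  refine squeeze_zero_norm (fun k => ?_) hlim
  rw [e]
  refine (norm_add_le _ _).trans (add_le_add ?_ ?_)
  · calc ‖⟪S (ξ k), T (η k - η' k)⟫_ℂ‖ ≤ ‖S (ξ k)‖ * ‖T (η k - η' k)‖ := norm_inner_le_norm _ _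
      _ ≤ (‖S‖ * ‖ξ k‖) * (‖T‖ * ‖η k - η' k‖) := by
        gcongr
        · exact S.le_opNorm _
        · exact T.le_opNorm _
      _ ≤ (‖S‖ * C) * (‖T‖ * ‖η k - η' k‖) := by
        gcongr
        exact hξ k
      _ = _ := by ring
  · calc ‖⟪S (ξ k - ξ' k), T (η' k)⟫_ℂ‖ ≤ ‖S (ξ k - ξ' k)‖ * ‖T (η' k)‖ := norm_inner_le_norm _ _
      _ ≤ (‖S‖ * ‖ξ k - ξ' k‖) * (‖T‖ * ‖η' k‖) := by
        gcongr
        · exact S.le_opNorm _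
        · exact T.le_opNorm _
      _ ≤ (‖S‖ * ‖ξ k - ξ' k‖) * (‖T‖ * D) := by
        gcongr
        exact hη' k
      _ = _ := by ring

end Hilbert

namespace TracialVN

variable {K : Type u} [NormedAddCommGroup K] [InnerProductSpace ℂ K] [CompleteSpace K]
  (M : TracialVN K)

/-- The map `y ↦ y z vec`. -/
def mulVecLeft (z : ↥M.alg) : ↥M.alg →+ K where
  toFun y := ((y * z : ↥M.alg) : K →L[ℂ] K) M.vec
  map_zero' := by rw [zero_mul]; rfl
  map_add' a b := by rw [add_mul]; rfl

/-- The map `y ↦ z y vec`. -/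
def mulVecRight (z : ↥M.alg) : ↥M.alg →+ K where
  toFun y := ((z * y : ↥M.alg) : K →L[ℂ] K) M.vec
  map_zero' := by rw [mul_zero]; rfl
  map_add' a b := by rw [mul_add]; rfl

variable {M}

/-- By traciality a factor on either side costs only its operator norm. The bound involves just the
2-norm of `y`, so approximants of `y` need not be bounded in operator norm. -/
theorem norm_mulVecLeft_le (z : M.BddSeq) (k : ℕ) (y : ↥M.alg) :
    ‖M.mulVecLeft (z k) y‖ ≤ ‖z‖ * ‖(y : K →L[ℂ] K) M.vec‖ :=
  (M.norm_mul_vec_le' y (z k)).trans (mul_le_mul_of_nonneg_right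
    (lp.norm_apply_le_norm ENNReal.top_ne_zero z k) (norm_nonneg _))

theorem norm_mulVecRight_le (z : M.BddSeq) (k : ℕ) (y : ↥M.alg) :
    ‖M.mulVecRight (z k) y‖ ≤ ‖z‖ * ‖(y : K →L[ℂ] K) M.vec‖ :=
  (M.norm_mul_vec_le (z k) y).trans (mul_le_mul_of_nonneg_right
    (lp.norm_apply_le_norm ENNReal.top_ne_zero z k) (norm_nonneg _))

/-- `y` is a limit in the `2`-norm of sums and differences of elements of `S`. -/
def IsApproximable (S : Set ↥M.alg) (y : ↥M.alg) : Prop :=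
  ∀ ε > 0, ∃ y₀ ∈ AddSubgroup.closure S, ‖((y - y₀ : ↥M.alg) : K →L[ℂ] K) M.vec‖ < ε

variable {l : Filter ℕ} {S : Set ↥M.alg}

theorem IsApproximable.tendsto_inner_right {y : ↥M.alg} (hy : IsApproximable S y) {w : ℕ → K}
    {C : ℝ} (hw : ∀ k, ‖w k‖ ≤ C) {v : ℕ → ↥M.alg →+ K} {D : ℝ}
    (hv : ∀ k a, ‖v k a‖ ≤ D * ‖(a : K →L[ℂ] K) M.vec‖)
    (h : ∀ a ∈ S, Tendsto (fun k => ⟪w k, v k a⟫_ℂ) l (𝓝 0)) :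
    Tendsto (fun k => ⟪w k, v k y⟫_ℂ) l (𝓝 0) := by
  have h1 : ∀ a ∈ AddSubgroup.closure S, Tendsto (fun k => ⟪w k, v k a⟫_ℂ) l (𝓝 0) := by
    intro a ha
    induction ha using AddSubgroup.closure_induction with
    | mem a ha => exact h a ha
    | zero => simpa using tendsto_const_nhds
    | add a b _ _ ha hb => simpa [inner_add_right] using ha.add hb
    | neg a _ ha => simpa [inner_neg_right] using ha.neg
  have hC : 0 ≤ C := (norm_nonneg _).trans (hw 0)
  rw [Metric.tendsto_nhds]
  intro ε hε
  -- The tolerance makes the error at most `ε / 2`; the added 1 keeps the denominator positive when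
  -- `C * |D| = 0`.
  obtain ⟨y₀, hy₀, hlt⟩ := hy (ε / (2 * (C * |D| + 1))) (by positivity)
  filter_upwards [Metric.tendsto_nhds.1 (h1 y₀ hy₀) (ε / 2) (by positivity)] with k hk
  rw [dist_zero_right] at hk ⊢
  have e : ⟪w k, v k y⟫_ℂ = ⟪w k, v k (y - y₀)⟫_ℂ + ⟪w k, v k y₀⟫_ℂ := by
    rw [← inner_add_right, ← map_add, sub_add_cancel]
  have h2 : ‖⟪w k, v k (y - y₀)⟫_ℂ‖ ≤ ε / 2 := by
    calc ‖⟪w k, v k (y - y₀)⟫_ℂ‖ ≤ ‖w k‖ * ‖v k (y - y₀)‖ := norm_inner_le_norm _ _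
      _ ≤ C * (|D| * (ε / (2 * (C * |D| + 1)))) := by
        gcongr
        · exact hw k
        · refine (hv k _).trans ?_
          gcongr
          exact le_abs_self D
      _ = C * |D| / (C * |D| + 1) * (ε / 2) := by
        field_simp
      _ ≤ 1 * (ε / 2) := by
        gcongr
        rw [div_le_one (by positivity)]
        linarith
      _ = ε / 2 := one_mul _
  rw [e]
  exact (norm_add_le _ _).trans_lt (by linarith)

theorem IsApproximable.tendsto_inner {y y' : ↥M.alg} (hy : IsApproximable S y)
    (hy' : IsApproximable S y') {u v : ℕ → ↥M.alg →+ K} {C D : ℝ}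
    (hu : ∀ k a, ‖u k a‖ ≤ C * ‖(a : K →L[ℂ] K) M.vec‖)
    (hv : ∀ k a, ‖v k a‖ ≤ D * ‖(a : K →L[ℂ] K) M.vec‖)
    (h : ∀ a ∈ S, ∀ b ∈ S, Tendsto (fun k => ⟪u k a, v k b⟫_ℂ) l (𝓝 0)) :
    Tendsto (fun k => ⟪u k y, v k y'⟫_ℂ) l (𝓝 0) := by
  have symm : ∀ a b : ℕ → K, Tendsto (fun k => ⟪a k, b k⟫_ℂ) l (𝓝 0) →
      Tendsto (fun k => ⟪b k, a k⟫_ℂ) l (𝓝 0) := by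
    intro a b hab
    have := (Complex.continuous_conj.tendsto _).comp hab
    rw [map_zero] at this
    exact this.congr fun k => inner_conj_symm _ _
  refine symm _ _ (hy.tendsto_inner_right (fun k => hv k y') hu fun a ha => symm _ _ ?_)
  exact hy'.tendsto_inner_right (fun k => hu k a) hv fun b hb => h a ha b hb

end TracialVN

/-! ### Negligible mass on wandering sets. -/

namespace CrossedProduct

variable {M₀ : Type u} [CStarAlgebra M₀] [PartialOrder M₀] [StarOrderedRing M₀] (τ₀ : M₀ →ₚ[ℂ] ℂ)
  {G : Type v} [Group G] (α : G →* (M₀ ≃⋆ₐ[ℂ] M₀))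

theorem norm_sq_eq_tsum (ξ : Space τ₀ α) : ‖ξ‖ ^ 2 = ∑' g, ‖ξ g‖ ^ 2 := by
  have := lp.norm_rpow_eq_tsum (p := 2) (by norm_num) ξ
  simpa using this

theorem summable_norm_sq (ξ : Space τ₀ α) : Summable fun g => ‖ξ g‖ ^ 2 := by
  have := (lp.memℓp ξ).summable (by norm_num)
  simpa using this

theorem norm_chi_apply_le (S : Set G) (ξ : Space τ₀ α) : ‖chi τ₀ α S ξ‖ ≤ ‖ξ‖ := by
  refine (sq_le_sq₀ (norm_nonneg _) (norm_nonneg _)).1 ?_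
  rw [norm_sq_eq_tsum, norm_sq_eq_tsum]
  refine Summable.tsum_le_tsum (fun g => ?_) (summable_norm_sq τ₀ α _) (summable_norm_sq τ₀ α _)
  by_cases h : g ∈ S
  · rw [chi_apply_of_mem h]
  · rw [chi_apply_of_notMem h, norm_zero, zero_pow two_ne_zero]
    exact sq_nonneg _

theorem sum_norm_chi_sq_le {ι : Type*} [Fintype ι] (S : ι → Set G)
    (hS : Pairwise fun i j => ∀ g ∈ S i, g ∉ S j) (ξ : Space τ₀ α) :
    ∑ i, ‖chi τ₀ α (S i) ξ‖ ^ 2 ≤ ‖ξ‖ ^ 2 := by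
  simp only [norm_sq_eq_tsum]
  rw [← Summable.tsum_finsetSum fun i _ => summable_norm_sq τ₀ α _]
  refine Summable.tsum_le_tsum (fun g => ?_)
    (summable_sum fun i _ => summable_norm_sq τ₀ α _) (summable_norm_sq τ₀ α _)
  by_cases h : ∃ i, g ∈ S i
  · obtain ⟨i, hi⟩ := h
    rw [Finset.sum_eq_single i, chi_apply_of_mem hi]
    · intro j _ hj
      rw [chi_apply_of_notMem (hS hj.symm g hi)]
      simp
    · simp
  · push Not at h
    rw [Finset.sum_eq_zero fun i _ => by rw [chi_apply_of_notMem (h i)]; simp]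
    exact sq_nonneg _

theorem inner_eq_zero_of_disjoint {ξ η : Space τ₀ α} (h : ∀ g, ξ g = 0 ∨ η g = 0) :
    ⟪ξ, η⟫_ℂ = 0 := by
  rw [lp.inner_eq_tsum]
  refine (tsum_congr fun g => ?_).trans tsum_zero
  rcases h g with h | h <;> simp [h]

theorem norm_gnsAut (β : M₀ ≃⋆ₐ[ℂ] M₀) (hβ : ∀ a, τ₀ (β a) = τ₀ a) (ξ : τ₀.GNS) :
    ‖gnsAut τ₀ β hβ ξ‖ = ‖ξ‖ := by
  induction ξ using gns_induction with
  | hp => exact isClosed_eq (by fun_prop) (by fun_prop)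
  | h b =>
    rw [gnsAut_gnsVec, @norm_eq_sqrt_re_inner ℂ, @norm_eq_sqrt_re_inner ℂ, inner_gnsVec,
      inner_gnsVec, ← map_star, ← map_mul, hβ]

variable (hτ₀ : IsFaithfulNormalTracialState τ₀) (hα : ∀ g a, τ₀ (α g a) = τ₀ a)

theorem rightLam_rightLam_inv (t : G) (ξ : Space τ₀ α) :
    rightLam τ₀ α hα t (rightLam τ₀ α hα t⁻¹ ξ) = ξ := by
  ext g
  rw [rightLam_apply, rightLam_apply, mul_inv_cancel_right]
  generalize ξ g = ζ
  induction ζ using gns_induction with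
  | hp => exact isClosed_eq (by fun_prop) (by fun_prop)
  | h b =>
    rw [gnsAut_gnsVec, gnsAut_gnsVec, ← StarAlgEquiv.mul_apply, ← map_mul]
    simp

/-- Conjugation by `λ(t)`. -/
def conjLam (t : G) : Space τ₀ α →L[ℂ] Space τ₀ α := rightLam τ₀ α hα t * lam τ₀ α t

/-- Conjugation by `λ(t)` permutes the coordinates by `g ↦ t g t⁻¹` and is isometric on each of
them. -/
theorem norm_chi_conjLam (S : Set G) (t : G) (ξ : Space τ₀ α) :
    ‖chi τ₀ α S (conjLam τ₀ α hα t ξ)‖ = ‖chi τ₀ α {g | t * g * t⁻¹ ∈ S} ξ‖ := by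
  refine (sq_eq_sq₀ (norm_nonneg _) (norm_nonneg _)).1 ?_
  rw [norm_sq_eq_tsum, norm_sq_eq_tsum, ← (MulAut.conj t).toEquiv.tsum_eq]
  refine tsum_congr fun g => ?_
  change ‖chi τ₀ α S (conjLam τ₀ α hα t ξ) (t * g * t⁻¹)‖ ^ 2 = _
  by_cases h : t * g * t⁻¹ ∈ S
  · rw [chi_apply_of_mem h, chi_apply_of_mem (S := {g | t * g * t⁻¹ ∈ S}) h, conjLam,
      mul_apply_eq_comp, rightLam_apply, norm_gnsAut, lam_apply]
    congr 3
    group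
  · rw [chi_apply_of_notMem h, chi_apply_of_notMem (S := {g | t * g * t⁻¹ ∈ S}) h]

/-- A bounded sequence of vectors which is asymptotically invariant under conjugation by `H` has
asymptotically no mass on wandering sets. -/
theorem tendsto_norm_chi_of_isWandering {H : Subgroup G} {B : Set G} (hB : IsWandering H B)
    {l : Filter ℕ} {ξ : ℕ → Space τ₀ α} {C : ℝ} (hξ : ∀ k, ‖ξ k‖ ≤ C)
    (hinv : ∀ t ∈ H, Tendsto (fun k => ‖conjLam τ₀ α hα t (ξ k) - ξ k‖) l (𝓝 0)) :
    Tendsto (fun k => ‖chi τ₀ α B (ξ k)‖) l (𝓝 0) := by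
  rw [Metric.tendsto_nhds]
  intro ε hε
  -- If the part of `ξ k` on `B` had norm at least `ε`, its parts on the `R` disjoint conjugates of
  -- `B` would each have norm at least `ε / 2`, against `R (ε / 2)² > C²`.
  obtain ⟨R, hR⟩ := exists_nat_gt (C ^ 2 / (ε / 2) ^ 2)
  rw [div_lt_iff₀ (by positivity)] at hR
  obtain ⟨t, htH, hdisj⟩ := hB R
  have hev : ∀ᶠ k in l, ∀ i, ‖conjLam τ₀ α hα (t i) (ξ k) - ξ k‖ < ε / 2 :=
    eventually_all.2 fun i => (hinv _ (htH i)).eventually_lt_const (by positivity)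
  filter_upwards [hev] with k hk
  rw [dist_zero_right, norm_norm]
  by_contra hge
  push Not at hge
  have h1 : ∀ i, ε / 2 ≤ ‖chi τ₀ α {g | t i * g * (t i)⁻¹ ∈ B} (ξ k)‖ := by
    intro i
    rw [← norm_chi_conjLam τ₀ α hα]
    have h2 : ‖chi τ₀ α B (ξ k)‖ ≤ ‖chi τ₀ α B (conjLam τ₀ α hα (t i) (ξ k))‖ +
        ‖chi τ₀ α B (conjLam τ₀ α hα (t i) (ξ k) - ξ k)‖ := by
      have e : chi τ₀ α B (ξ k) = chi τ₀ α B (conjLam τ₀ α hα (t i) (ξ k)) -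
          chi τ₀ α B (conjLam τ₀ α hα (t i) (ξ k) - ξ k) := by
        rw [map_sub, sub_sub_cancel]
      rw [e]
      exact norm_sub_le _ _
    have h3 := norm_chi_apply_le τ₀ α B (conjLam τ₀ α hα (t i) (ξ k) - ξ k)
    linarith [hk i]
  have h4 := sum_norm_chi_sq_le τ₀ α (fun i => {g | t i * g * (t i)⁻¹ ∈ B})
    (fun i j hij g hg => hdisj hij g hg) (ξ k)
  have h5 : (R : ℝ) * (ε / 2) ^ 2 ≤ ∑ i, ‖chi τ₀ α {g | t i * g * (t i)⁻¹ ∈ B} (ξ k)‖ ^ 2 := by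
    calc (R : ℝ) * (ε / 2) ^ 2 = ∑ _i : Fin R, (ε / 2) ^ 2 := by simp
      _ ≤ _ := Finset.sum_le_sum fun i _ => by
        have := h1 i
        gcongr
  have h6 : ‖ξ k‖ ^ 2 ≤ C ^ 2 := by
    have := hξ k
    gcongr
  linarith

end CrossedProduct

/-! ### Vanishing of the cross terms and the commutator inequality. -/

namespace CrossedProduct

variable {M₀ : Type u} [CStarAlgebra M₀] [PartialOrder M₀] [StarOrderedRing M₀] (τ₀ : M₀ →ₚ[ℂ] ℂ)
  {G : Type v} [Group G] (α : G →* (M₀ ≃⋆ₐ[ℂ] M₀))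
  (hτ₀ : IsFaithfulNormalTracialState τ₀) (hα : ∀ g a, τ₀ (α g a) = τ₀ a)

theorem chi_apply_eq_zero {S : Set G} {ξ : Space τ₀ α} {g : G} (h : chi τ₀ α S ξ g ≠ 0) : g ∈ S := by
  by_contra hg
  exact h (chi_apply_of_notMem hg ξ)

/-- The element `λ(k) c` of the crossed product. -/
def mono (k : G) (c : M₀) : ↥(crossedProduct τ₀ hτ₀ α hα).alg :=
  ⟨incl τ₀ α (α k c) * lam τ₀ α k,
    mul_mem (incl_mem_vn τ₀ α ⊤ _) (lam_mem_vn τ₀ α (Subgroup.mem_top k))⟩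

/-- Right multiplication by `λ(k) c`. -/
def rightMono (k : G) (c : M₀) : Space τ₀ α →L[ℂ] Space τ₀ α :=
  rightLam τ₀ α hα k⁻¹ * right τ₀ α hτ₀ (α k c)

open Classical in
theorem mono_vec (k : G) (c : M₀) :
    (mono τ₀ α hτ₀ hα k c : Space τ₀ α →L[ℂ] Space τ₀ α) (vec τ₀ α) =
      (lp.single 2 k (gnsVec τ₀ c) : Space τ₀ α) :=
  (single_eq_incl_lam τ₀ α k c).symm

/-- As `z` commutes with right multiplications, `z λ(k) c` is expressed by one bounded operator,
independent of `z`, applied to the vector of `z`. Limits along a sequence of `z` can then be taken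
on vectors alone. -/
theorem mul_mono_vec (z : ↥(crossedProduct τ₀ hτ₀ α hα).alg) (k : G) (c : M₀) :
    ((z * mono τ₀ α hτ₀ hα k c : ↥(crossedProduct τ₀ hτ₀ α hα).alg) :
        Space τ₀ α →L[ℂ] Space τ₀ α) (vec τ₀ α) =
      rightMono τ₀ α hτ₀ hα k c ((z : Space τ₀ α →L[ℂ] Space τ₀ α) (vec τ₀ α)) := by
  classical
  change (z : Space τ₀ α →L[ℂ] Space τ₀ α)
    ((mono τ₀ α hτ₀ hα k c : Space τ₀ α →L[ℂ] Space τ₀ α) (vec τ₀ α)) = _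
  rw [mono_vec, apply_single τ₀ α hτ₀ hα z.2]
  rfl

theorem mono_apply_ne_zero {k : G} {c : M₀} {ξ : Space τ₀ α} {g : G}
    (h : (mono τ₀ α hτ₀ hα k c : Space τ₀ α →L[ℂ] Space τ₀ α) ξ g ≠ 0) : ξ (k⁻¹ * g) ≠ 0 := by
  intro h0
  refine h ?_
  change (incl τ₀ α (α k c) * lam τ₀ α k) ξ g = 0
  rw [mul_apply_eq_comp, incl_apply, lam_apply, h0, map_zero]

theorem rightMono_apply_ne_zero {k : G} {c : M₀} {ξ : Space τ₀ α} {g : G}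
    (h : rightMono τ₀ α hτ₀ hα k c ξ g ≠ 0) : ξ (g * k⁻¹) ≠ 0 := by
  intro h0
  refine h ?_
  rw [rightMono, mul_apply_eq_comp, rightLam_apply, right_apply, h0, map_zero, map_zero]

theorem inner_eq_zero_of_ne {ξ η : Space τ₀ α} (h : ∀ g, ξ g ≠ 0 → η g ≠ 0 → False) :
    ⟪ξ, η⟫_ℂ = 0 :=
  inner_eq_zero_of_disjoint τ₀ α fun g => by
    by_contra hg
    push Not at hg
    exact h g hg.1 hg.2

section Separates

variable {H : Subgroup G} {k k' : G} {S : Set G} (hS : Separates H k k' S) (c c' : M₀)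
  (ξ η : Space τ₀ α)

include hS

/-- This and the next four results treat the five cross terms of `norm_sq_add_norm_sq_le`; each
field of `Separates` makes one pair of supports disjoint. -/
theorem inner_mono_rightMono :
    ⟪(mono τ₀ α hτ₀ hα k c : Space τ₀ α →L[ℂ] Space τ₀ α) (chi τ₀ α S ξ),
      rightMono τ₀ α hτ₀ hα k' c' (chi τ₀ α S η)⟫_ℂ = 0 :=
  inner_eq_zero_of_ne τ₀ α fun g h1 h2 =>
    hS.left_right _ (chi_apply_eq_zero τ₀ α (mono_apply_ne_zero τ₀ α hτ₀ hα h1))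
      _ (chi_apply_eq_zero τ₀ α (rightMono_apply_ne_zero τ₀ α hτ₀ hα h2)) (by group)

theorem inner_mono_mono :
    ⟪(mono τ₀ α hτ₀ hα k c : Space τ₀ α →L[ℂ] Space τ₀ α) (chi τ₀ α S ξ),
      (mono τ₀ α hτ₀ hα k' c' : Space τ₀ α →L[ℂ] Space τ₀ α) (chi τ₀ α H η)⟫_ℂ = 0 :=
  inner_eq_zero_of_ne τ₀ α fun g h1 h2 =>
    hS.left_coset_left _ (chi_apply_eq_zero τ₀ α (mono_apply_ne_zero τ₀ α hτ₀ hα h1))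
      _ (chi_apply_eq_zero τ₀ α (mono_apply_ne_zero τ₀ α hτ₀ hα h2)) (by group)

theorem inner_mono_rightMono_chi :
    ⟪(mono τ₀ α hτ₀ hα k c : Space τ₀ α →L[ℂ] Space τ₀ α) (chi τ₀ α S ξ),
      rightMono τ₀ α hτ₀ hα k' c' (chi τ₀ α H η)⟫_ℂ = 0 :=
  inner_eq_zero_of_ne τ₀ α fun g h1 h2 =>
    hS.left_coset_right _ (chi_apply_eq_zero τ₀ α (mono_apply_ne_zero τ₀ α hτ₀ hα h1))
      _ (chi_apply_eq_zero τ₀ α (rightMono_apply_ne_zero τ₀ α hτ₀ hα h2)) (by group)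

theorem inner_rightMono_mono_chi :
    ⟪rightMono τ₀ α hτ₀ hα k c (chi τ₀ α S ξ),
      (mono τ₀ α hτ₀ hα k' c' : Space τ₀ α →L[ℂ] Space τ₀ α) (chi τ₀ α H η)⟫_ℂ = 0 :=
  inner_eq_zero_of_ne τ₀ α fun g h1 h2 =>
    hS.right_coset_left _ (chi_apply_eq_zero τ₀ α (rightMono_apply_ne_zero τ₀ α hτ₀ hα h1))
      _ (chi_apply_eq_zero τ₀ α (mono_apply_ne_zero τ₀ α hτ₀ hα h2)) (by group)

theorem inner_rightMono_rightMono :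
    ⟪rightMono τ₀ α hτ₀ hα k c (chi τ₀ α S ξ),
      rightMono τ₀ α hτ₀ hα k' c' (chi τ₀ α H η)⟫_ℂ = 0 :=
  inner_eq_zero_of_ne τ₀ α fun g h1 h2 =>
    hS.right_coset_right _ (chi_apply_eq_zero τ₀ α (rightMono_apply_ne_zero τ₀ α hτ₀ hα h1))
      _ (chi_apply_eq_zero τ₀ α (rightMono_apply_ne_zero τ₀ α hτ₀ hα h2)) (by group)

end Separates

/-- Elements with vanishing expectation onto `M_L` are approximated by combinations of
`λ(k) c`, `k ∉ L`. -/
theorem isApproximable_of_condE_eq_zero (L : Subgroup G) (y : ↥(crossedProduct τ₀ hτ₀ α hα).alg)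
    (hy : (crossedProduct τ₀ hτ₀ α hα).condE (crossedSub τ₀ hτ₀ α hα L) y = 0) :
    TracialVN.IsApproximable {a | ∃ k ∉ L, ∃ c, mono τ₀ α hτ₀ hα k c = a} y := by
  classical
  set S : Set ↥(crossedProduct τ₀ hτ₀ α hα).alg := {a | ∃ k ∉ L, ∃ c, mono τ₀ α hτ₀ hα k c = a}
  set η : Space τ₀ α := (y : Space τ₀ α →L[ℂ] Space τ₀ α) (vec τ₀ α) with hη
  have h1 := (hasExpectation_crossedSub τ₀ α hτ₀ hα L).condE_vec y
  rw [hy] at h1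
  have h2 : chi τ₀ α L η = 0 := h1.symm
  have h3 : chi τ₀ α (L : Set G)ᶜ η = η := by
    ext g
    by_cases hg : g ∈ (L : Set G)
    · rw [chi_apply_of_notMem (by simpa using hg), ← chi_apply_of_mem hg η, h2]
      rfl
    · rw [chi_apply_of_mem (by simpa using hg)]
  let f : ↥(crossedProduct τ₀ hτ₀ α hα).alg →+ Space τ₀ α :=
    { toFun := fun a => (a : Space τ₀ α →L[ℂ] Space τ₀ α) (vec τ₀ α)
      map_zero' := rfl
      map_add' := fun _ _ => rfl }
  let V : AddSubgroup (Space τ₀ α) := (AddSubgroup.closure S).map f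
  have h4 : η ∈ closure (V : Set (Space τ₀ α)) := by
    rw [← AddSubgroup.topologicalClosure_coe, ← h3]
    refine chi_mem_of_single τ₀ α V.topologicalClosure V.isClosed_topologicalClosure _
      (fun g hg b => V.le_topologicalClosure ?_) η
    exact ⟨_, AddSubgroup.subset_closure ⟨g, hg, b, rfl⟩, mono_vec τ₀ α hτ₀ hα g b⟩
  intro ε hε
  obtain ⟨_, ⟨y₀, hy₀, rfl⟩, hlt⟩ := Metric.mem_closure_iff.1 h4 ε hε
  rw [dist_eq_norm] at hlt
  exact ⟨y₀, hy₀, hlt⟩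

variable {ω : Ultrafilter ℕ}

/-- Representatives of elements of the ultrapower commuting with `λ(t)` are asymptotically
invariant under conjugation. -/
theorem tendsto_conjLam_sub (x : (crossedProduct τ₀ hτ₀ α hα).BddSeq) {H : Subgroup G}
    (hx : ∀ a ∈ crossedSub τ₀ hτ₀ α hα H,
      (crossedProduct τ₀ hτ₀ α hα).ofSeq ω x * (crossedProduct τ₀ hτ₀ α hα).const ω a =
        (crossedProduct τ₀ hτ₀ α hα).const ω a * (crossedProduct τ₀ hτ₀ α hα).ofSeq ω x)
    {t : G} (ht : t ∈ H) :
    Tendsto (fun k => ‖conjLam τ₀ α hα t ((x k : Space τ₀ α →L[ℂ] Space τ₀ α) (vec τ₀ α)) -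
      (x k : Space τ₀ α →L[ℂ] Space τ₀ α) (vec τ₀ α)‖) ω (𝓝 0) := by
  have h1 : mono τ₀ α hτ₀ hα t 1 ∈ crossedSub τ₀ hτ₀ α hα H := by
    change incl τ₀ α (α t 1) * lam τ₀ α t ∈ vn τ₀ α H
    exact mul_mem (incl_mem_vn τ₀ α H _) (lam_mem_vn τ₀ α ht)
  have h2 := hx _ h1
  rw [TracialVN.const, ← map_mul, ← map_mul, TracialVN.ofSeq_eq_iff] at h2
  have h3 := h2.const_mul ‖rightLam τ₀ α hα t‖
  rw [mul_zero] at h3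
  refine squeeze_zero (fun _ => norm_nonneg _) (fun k => ?_) h3
  set ξ : Space τ₀ α := (x k : Space τ₀ α →L[ℂ] Space τ₀ α) (vec τ₀ α) with hξ
  have e1 := mul_mono_vec τ₀ α hτ₀ hα (x k) t 1
  rw [← hξ] at e1
  have e2 : rightMono τ₀ α hτ₀ hα t 1 ξ = rightLam τ₀ α hα t⁻¹ ξ := by
    rw [rightMono, mul_apply_eq_comp]
    congr 1
    ext g
    rw [right_apply, map_one]
    generalize ξ g = ζ
    induction ζ using gns_induction with
    | hp => exact isClosed_eq (by fun_prop) (by fun_prop)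
    | h b => rw [gnsRight_gnsVec, mul_one]
  have e3 : (mono τ₀ α hτ₀ hα t 1 : Space τ₀ α →L[ℂ] Space τ₀ α) ξ = lam τ₀ α t ξ := by
    change (incl τ₀ α (α t 1) * lam τ₀ α t) ξ = _
    ext g
    rw [mul_apply_eq_comp, incl_apply, map_one, map_one, map_one, one_apply_eq_self]
  -- Up to a right multiplication, the difference is the vector of the commutator of `λ(t)` with `x
  -- k`.
  have e4 : conjLam τ₀ α hα t ξ - ξ =
      rightLam τ₀ α hα t (lam τ₀ α t ξ - rightLam τ₀ α hα t⁻¹ ξ) := by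
    rw [map_sub, rightLam_rightLam_inv]
    rfl
  rw [e4]
  refine ((rightLam τ₀ α hα t).le_opNorm _).trans_eq ?_
  congr 1
  rw [norm_sub_rev, ← e2, ← e1, ← e3]
  rfl

/-- The commutator inequality, for a pair of subgroups `H ≤ L` such that elements outside of `L`
translate the complement of the union of `L` with two wandering sets away from itself. -/
theorem commutator_inequality {H L : Subgroup G} (hHL : H ≤ L)
    (hsep : ∀ k ∉ L, ∀ k' ∉ L, ∃ B₁ B₂ : Set G, IsWandering H B₁ ∧ IsWandering H B₂ ∧
      Separates H k k' {g | g ∉ L ∧ g ∉ B₁ ∧ g ∉ B₂})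
    (x : (crossedProduct τ₀ hτ₀ α hα).Ultrapower ω)
    (hxA : ∀ a ∈ crossedSub τ₀ hτ₀ α hα H,
      x * (crossedProduct τ₀ hτ₀ α hα).const ω a = (crossedProduct τ₀ hτ₀ α hα).const ω a * x)
    (hxE : (crossedProduct τ₀ hτ₀ α hα).ultraCondE ω (crossedSub τ₀ hτ₀ α hα L) x =
      (crossedProduct τ₀ hτ₀ α hα).ultraCondE ω (crossedSub τ₀ hτ₀ α hα H) x)
    (y : ↥(crossedProduct τ₀ hτ₀ α hα).alg)
    (hy : (crossedProduct τ₀ hτ₀ α hα).condE (crossedSub τ₀ hτ₀ α hα L) y = 0) :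
    (crossedProduct τ₀ hτ₀ α hα).ultraNorm2 ω
        ((crossedProduct τ₀ hτ₀ α hα).const ω y *
          (x - (crossedProduct τ₀ hτ₀ α hα).ultraCondE ω (crossedSub τ₀ hτ₀ α hα H) x)) ^ 2 +
      (crossedProduct τ₀ hτ₀ α hα).ultraNorm2 ω
        ((x - (crossedProduct τ₀ hτ₀ α hα).ultraCondE ω (crossedSub τ₀ hτ₀ α hα H) x) *
          (crossedProduct τ₀ hτ₀ α hα).const ω y) ^ 2 ≤
    (crossedProduct τ₀ hτ₀ α hα).ultraNorm2 ω
        ((crossedProduct τ₀ hτ₀ α hα).const ω y * x -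
          x * (crossedProduct τ₀ hτ₀ α hα).const ω y) ^ 2 := by
  obtain ⟨X, rfl⟩ := Ideal.Quotient.mk_surjective x
  obtain ⟨e, -, he, hee⟩ :=
    (hasExpectation_crossedSub τ₀ α hτ₀ hα H).ultraCondE_ofSeq ω X
  obtain ⟨f, -, hf, hff⟩ :=
    (hasExpectation_crossedSub τ₀ α hτ₀ hα L).ultraCondE_ofSeq ω X
  rw [hee, hff, TracialVN.ofSeq_eq_iff] at hxE
  rw [hee]
  let ξ : ℕ → Space τ₀ α := fun k => (X k : Space τ₀ α →L[ℂ] Space τ₀ α) (vec τ₀ α)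
  have hξ : ∀ k, ‖ξ k‖ ≤ ‖X‖ := fun k => by
    have h := TracialVN.norm_mulVecLeft_le X k 1
    change ‖((1 * X k : ↥(crossedProduct τ₀ hτ₀ α hα).alg) : Space τ₀ α →L[ℂ] Space τ₀ α) (crossedProduct τ₀ hτ₀ α hα).vec‖ ≤ ‖X‖ * ‖(crossedProduct τ₀ hτ₀ α hα).vec‖ at h
    rwa [one_mul, (crossedProduct τ₀ hτ₀ α hα).norm_vec, mul_one] at h
  -- Equality of the two expectations says that asymptotically the part of `ξ k` on `L` sits on `H`.
  have hLH : Tendsto (fun k => ‖chi τ₀ α L (ξ k) - chi τ₀ α H (ξ k)‖) ω (𝓝 0) :=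
    hxE.congr fun k => by rw [hf, he]; rfl
  have hwand : ∀ B, IsWandering H B → Tendsto (fun k => ‖chi τ₀ α B (ξ k)‖) ω (𝓝 0) :=
    fun B hB => tendsto_norm_chi_of_isWandering τ₀ α hα hB hξ fun t ht =>
      tendsto_conjLam_sub τ₀ α hτ₀ hα X hxA ht
  set Z : (crossedProduct τ₀ hτ₀ α hα).BddSeq := X - e with hZ
  have hZv : ∀ k, (Z k : Space τ₀ α →L[ℂ] Space τ₀ α) (vec τ₀ α) = ξ k - chi τ₀ α H (ξ k) :=
    fun k =>
    congrArg (ξ k - ·) (he k)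
  have hev : ∀ k, (e k : Space τ₀ α →L[ℂ] Space τ₀ α) (vec τ₀ α) = chi τ₀ α H (ξ k) := he
  have hchi : ∀ S k, ‖chi τ₀ α S (ξ k)‖ ≤ ‖X‖ := fun S k =>
    (norm_chi_apply_le τ₀ α S _).trans (hξ k)
  have hζ : ∀ k, ‖ξ k - chi τ₀ α H (ξ k)‖ ≤ ‖X‖ + ‖X‖ := fun k =>
    (norm_sub_le _ _).trans (add_le_add (hξ k) (hchi _ k))
  have happrox : ∀ B₁ B₂, IsWandering H B₁ → IsWandering H B₂ →
      Tendsto (fun k => ‖ξ k - chi τ₀ α H (ξ k) -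
        chi τ₀ α {g | g ∉ L ∧ g ∉ B₁ ∧ g ∉ B₂} (ξ k)‖) ω (𝓝 0) := by
    intro B₁ B₂ h1 h2
    have h3 := (hLH.add (hwand B₁ h1)).add (hwand B₂ h2)
    rw [add_zero, add_zero] at h3
    refine squeeze_zero (fun _ => norm_nonneg _) (fun k => ?_) h3
    -- What is lost outside the good set is split disjointly into the parts on `L \ H`, on `B₁` off
    -- `L`, and on `B₂` off `L` and `B₁`; each is negligible.
    have e1 : ξ k - chi τ₀ α H (ξ k) - chi τ₀ α {g | g ∉ L ∧ g ∉ B₁ ∧ g ∉ B₂} (ξ k) =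
        chi τ₀ α L (ξ k) - chi τ₀ α H (ξ k) + chi τ₀ α {g | g ∉ L} (chi τ₀ α B₁ (ξ k)) +
          chi τ₀ α {g | g ∉ L ∧ g ∉ B₁} (chi τ₀ α B₂ (ξ k)) := by
      ext g
      simp only [lp.coeFn_sub, lp.coeFn_add, Pi.sub_apply, Pi.add_apply, chi_apply,
        Set.mem_ofPred_eq]
      by_cases hL : g ∈ L
      · by_cases hH : g ∈ (H : Set G) <;> simp [hL, hH]
      · have hH : g ∉ (H : Set G) := fun h => hL (hHL h)
        by_cases hB₁ : g ∈ B₁ <;> by_cases hB₂ : g ∈ B₂ <;> simp [hL, hH, hB₁, hB₂]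
    rw [e1]
    refine (norm_add_le _ _).trans (add_le_add ((norm_add_le _ _).trans (add_le_add le_rfl ?_)) ?_)
    · exact norm_chi_apply_le τ₀ α _ _
    · exact norm_chi_apply_le τ₀ α _ _
  have hzero : Tendsto (fun k => ‖chi τ₀ α H (ξ k) - chi τ₀ α H (ξ k)‖) ω (𝓝 0) := by
    simp
  have happ := isApproximable_of_condE_eq_zero τ₀ α hτ₀ hα L y hy
  -- For each cross term, `y` is first reduced to monomials `λ(k) c` with `k ∉ L`. The wandering
  -- sets may then depend on the pair `k, k'`, since `Z` is concentrated off any such pair of sets.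
  have hab : Tendsto (fun k => ⟪(crossedProduct τ₀ hτ₀ α hα).mulVecLeft (Z k) y,
      (crossedProduct τ₀ hτ₀ α hα).mulVecRight (Z k) y⟫_ℂ) ω (𝓝 0) := by
    refine happ.tendsto_inner happ (TracialVN.norm_mulVecLeft_le Z)
      (TracialVN.norm_mulVecRight_le Z) ?_
    rintro _ ⟨k, hk, c, rfl⟩ _ ⟨k', hk', c', rfl⟩
    obtain ⟨B₁, B₂, h1, h2, hS⟩ := hsep k hk k' hk'
    refine (tendsto_inner_of_approx _ _ hζ (hchi _) (happrox B₁ B₂ h1 h2) (happrox B₁ B₂ h1 h2)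
      fun j => inner_mono_rightMono τ₀ α hτ₀ hα hS c c' (ξ j) (ξ j)).congr fun j => ?_
    rw [← hZv, ← mul_mono_vec]
    rfl
  have hac : Tendsto (fun k => ⟪(crossedProduct τ₀ hτ₀ α hα).mulVecLeft (Z k) y,
      (crossedProduct τ₀ hτ₀ α hα).mulVecLeft (e k) y⟫_ℂ) ω (𝓝 0) := by
    refine happ.tendsto_inner happ (TracialVN.norm_mulVecLeft_le Z)
      (TracialVN.norm_mulVecLeft_le e) ?_
    rintro _ ⟨k, hk, c, rfl⟩ _ ⟨k', hk', c', rfl⟩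
    obtain ⟨B₁, B₂, h1, h2, hS⟩ := hsep k hk k' hk'
    refine (tendsto_inner_of_approx _ _ hζ (hchi _) (happrox B₁ B₂ h1 h2) hzero
      fun j => inner_mono_mono τ₀ α hτ₀ hα hS c c' (ξ j) (ξ j)).congr fun j => ?_
    rw [← hZv, ← hev]
    rfl
  have had : Tendsto (fun k => ⟪(crossedProduct τ₀ hτ₀ α hα).mulVecLeft (Z k) y,
      (crossedProduct τ₀ hτ₀ α hα).mulVecRight (e k) y⟫_ℂ) ω (𝓝 0) := by
    refine happ.tendsto_inner happ (TracialVN.norm_mulVecLeft_le Z)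
      (TracialVN.norm_mulVecRight_le e) ?_
    rintro _ ⟨k, hk, c, rfl⟩ _ ⟨k', hk', c', rfl⟩
    obtain ⟨B₁, B₂, h1, h2, hS⟩ := hsep k hk k' hk'
    refine (tendsto_inner_of_approx _ _ hζ (hchi _) (happrox B₁ B₂ h1 h2) hzero
      fun j => inner_mono_rightMono_chi τ₀ α hτ₀ hα hS c c' (ξ j) (ξ j)).congr fun j => ?_
    rw [← hZv, ← hev, ← mul_mono_vec]
    rfl
  have hbc : Tendsto (fun k => ⟪(crossedProduct τ₀ hτ₀ α hα).mulVecRight (Z k) y,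
      (crossedProduct τ₀ hτ₀ α hα).mulVecLeft (e k) y⟫_ℂ) ω (𝓝 0) := by
    refine happ.tendsto_inner happ (TracialVN.norm_mulVecRight_le Z)
      (TracialVN.norm_mulVecLeft_le e) ?_
    rintro _ ⟨k, hk, c, rfl⟩ _ ⟨k', hk', c', rfl⟩
    obtain ⟨B₁, B₂, h1, h2, hS⟩ := hsep k hk k' hk'
    refine (tendsto_inner_of_approx _ _ hζ (hchi _) (happrox B₁ B₂ h1 h2) hzero
      fun j => inner_rightMono_mono_chi τ₀ α hτ₀ hα hS c c' (ξ j) (ξ j)).congr fun j => ?_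
    rw [← hZv, ← hev, ← mul_mono_vec]
    rfl
  have hbd : Tendsto (fun k => ⟪(crossedProduct τ₀ hτ₀ α hα).mulVecRight (Z k) y,
      (crossedProduct τ₀ hτ₀ α hα).mulVecRight (e k) y⟫_ℂ) ω (𝓝 0) := by
    refine happ.tendsto_inner happ (TracialVN.norm_mulVecRight_le Z)
      (TracialVN.norm_mulVecRight_le e) ?_
    rintro _ ⟨k, hk, c, rfl⟩ _ ⟨k', hk', c', rfl⟩
    obtain ⟨B₁, B₂, h1, h2, hS⟩ := hsep k hk k' hk'
    refine (tendsto_inner_of_approx _ _ hζ (hchi _) (happrox B₁ B₂ h1 h2) hzero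
      fun j => inner_rightMono_rightMono τ₀ α hτ₀ hα hS c c' (ξ j) (ξ j)).congr fun j => ?_
    rw [← hZv, ← hev, ← mul_mono_vec, ← mul_mono_vec]
    rfl
  have hrest := (((hab.neg.add hac).sub had).sub hbc).add hbd
  have hrest' := ((Complex.continuous_re.tendsto _).comp hrest).const_mul 2
  simp only [neg_zero, add_zero, sub_zero, Complex.zero_re, mul_zero] at hrest'
  let Y : (crossedProduct τ₀ hτ₀ α hα).BddSeq := ⟨fun _ => y, memℓp_infty ⟨‖y‖, by rintro _ ⟨_, rfl⟩; exact le_rfl⟩⟩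
  have hl := (((TracialVN.tendsto_norm_sq ω (Y * Z)).add
    (TracialVN.tendsto_norm_sq ω (Z * Y))).add hrest')
  have hr := TracialVN.tendsto_norm_sq ω (Y * X - X * Y)
  rw [add_zero] at hl
  refine le_of_tendsto_of_tendsto' hl hr fun k => ?_
  refine (norm_sq_add_norm_sq_le ((crossedProduct τ₀ hτ₀ α hα).mulVecLeft (Z k) y) ((crossedProduct τ₀ hτ₀ α hα).mulVecRight (Z k) y)
    ((crossedProduct τ₀ hτ₀ α hα).mulVecLeft (e k) y) ((crossedProduct τ₀ hτ₀ α hα).mulVecRight (e k) y)).trans_eq ?_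
  congr 2
  have e1 : (Y * X - X * Y) k = y * Z k - Z k * y + (y * e k - e k * y) := by
    have : X k = Z k + e k := (sub_add_cancel (X k) (e k)).symm
    change y * X k - X k * y = _
    rw [this]
    noncomm_ring
  rw [e1]
  rfl

end CrossedProduct

end

theorem lemma3p2 {M₀ : Type u} [CStarAlgebra M₀] [PartialOrder M₀] [StarOrderedRing M₀]
    [WStarAlgebra M₀] (τ₀ : M₀ →ₚ[ℂ] ℂ) (hτ₀ : IsFaithfulNormalTracialState τ₀)
    {N : ℕ} (n : Fin N → ℕ) (hn : ∀ i, 2 ≤ n i)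
    (α : FreeProd n →* (M₀ ≃⋆ₐ[ℂ] M₀)) (hα : ∀ g a, τ₀ (α g a) = τ₀ a)
    (ω : Ultrafilter ℕ) (hω : (ω : Filter ℕ) ≤ Filter.cofinite)
    (x : (crossedProduct τ₀ hτ₀ α hα).Ultrapower ω)
    (hxA : ∀ a ∈ algA τ₀ hτ₀ hn α hα,
      x * (crossedProduct τ₀ hτ₀ α hα).const ω a = (crossedProduct τ₀ hτ₀ α hα).const ω a * x)
    (hxE : ∀ i, (crossedProduct τ₀ hτ₀ α hα).ultraCondE ω (algN τ₀ hτ₀ hn α hα i) x =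
      (crossedProduct τ₀ hτ₀ α hα).ultraCondE ω (algA τ₀ hτ₀ hn α hα) x)
    (y : ↥(crossedProduct τ₀ hτ₀ α hα).alg)
    (hyN : ∀ i, (crossedProduct τ₀ hτ₀ α hα).condE (algN τ₀ hτ₀ hn α hα i) y = 0)
    (hyA : (crossedProduct τ₀ hτ₀ α hα).condE (algA τ₀ hτ₀ hn α hα) y = 0) :
    (crossedProduct τ₀ hτ₀ α hα).ultraNorm2 ω
        ((crossedProduct τ₀ hτ₀ α hα).const ω y * x -
          x * (crossedProduct τ₀ hτ₀ α hα).const ω y) ^ 2 ≥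
      (crossedProduct τ₀ hτ₀ α hα).ultraNorm2 ω
        ((crossedProduct τ₀ hτ₀ α hα).const ω y *
          (x - (crossedProduct τ₀ hτ₀ α hα).ultraCondE ω (algA τ₀ hτ₀ hn α hα) x)) ^ 2 +
      (crossedProduct τ₀ hτ₀ α hα).ultraNorm2 ω
        ((x - (crossedProduct τ₀ hτ₀ α hα).ultraCondE ω (algA τ₀ hτ₀ hn α hα) x) *
          (crossedProduct τ₀ hτ₀ α hα).const ω y) ^ 2 := by
  -- For the empty product `G` is trivial and `A` is all of `M`, so `E_A(y) = 0` gives `y = 0`.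
  -- Otherwise the inequality is applied in the coordinate of index 0.
  rcases Nat.eq_zero_or_pos N with rfl | hN
  · have htop : subH n hn = ⊤ := by
      rw [eq_top_iff]
      exact fun g _ i => i.elim0
    have h := (CrossedProduct.hasExpectation_crossedSub τ₀ α hτ₀ hα (subH n hn)).condE_vec y
    have h' : (crossedProduct τ₀ hτ₀ α hα).condE
      (crossedSub τ₀ hτ₀ α hα (subH n hn)) y = 0 := hyA
    rw [h', htop, Subgroup.coe_top, CrossedProduct.chi_univ] at h
    have hy0 : y = 0 := Subtype.ext ((crossedProduct τ₀ hτ₀ α hα).separating y y.2 h.symm)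
    have hc : (crossedProduct τ₀ hτ₀ α hα).const ω y = 0 := by
      rw [hy0]
      exact map_zero (Ideal.Quotient.mk ((crossedProduct τ₀ hτ₀ α hα).nullIdeal ω))
    have h0 : (crossedProduct τ₀ hτ₀ α hα).ultraNorm2 ω 0 ^ 2 = 0 := by
      refine tendsto_nhds_unique
        (TracialVN.tendsto_norm_sq ω (0 : (crossedProduct τ₀ hτ₀ α hα).BddSeq)) ?_
      simp
    rw [hc]
    simp only [zero_mul, mul_zero, h0, add_zero, ge_iff_le]
    positivity
  · exact CrossedProduct.commutator_inequality τ₀ α hτ₀ hα (subH_le_subG hn ⟨0, hN⟩)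
      (fun k hk k' hk' => exists_wandering_separates hn ⟨0, hN⟩ hk hk') x hxA
      (hxE ⟨0, hN⟩) y (hyN ⟨0, hN⟩)
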